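/- Conventions. For a finite arrangement $\mathcal A$ of affine hyperplanes in $\mathbb R^n$, let $L(\mathcal A)$ be the set of nonempty intersections of hyperplanes of $\mathcal A$ (including $\mathbb R^n$, the empty intersection), ordered by reverse inclusion, with Möbius function $\mu$. The Whitney polynomial is $$w(\mathcal A,x,t)=\sum_{X\le Y\text{ in }L(\mathcal A)}\mu(X,Y)\,x^{n-\dim X}t^{\dim Y}.$$ A face of $\mathcal A$ is a connected component of $X\setminus\bigcup_{H\in\mathcal A,\,X\not\subseteq H}H$ for some $X\in L(\mathcal A)$; its dimension is the dimension of its affine hull. The level of a set $A\subseteq\mathbb R^n$ is the smallest dimension of a linear subspace $W$ of $\mathbb R^n$ such that the distances $d(v,W)$, $v\in A$, are uniformly bounded. Let $f_{d,l}(\mathcal A)$ be the number of faces of $\mathcal A$ of dimension $d$ and level $l$. A deformed braid arrangement in $\mathbb R^n$ consists of the hyperplanes $x_i-x_j=a$ with $1\le i<j\le n$ and $a\in S_{ij}$, where each $S_{ij}$ is a nonempty finite set of real numbers. An exponential sequence of arrangements (ESA) is a sequence $(\mathcal A_1,\mathcal A_2,\dots)$ in which $\mathcal A_n$ is a deformed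 braid arrangement in $\mathbb R^n$ and, for every $n\ge 1$ and every nonempty $S\subseteq\{1,\dots,n\}$, the posets $L(\mathcal A_n^S)$ and $L(\mathcal A_{|S|})$ are isomorphic, where $\mathcal A_n^S$ is the set of those $H\in\mathcal A_n$ that are parallel to $x_i-x_j=0$ for some distinct $i,j\in S$. Theorem. Let $(\mathcal A_1,\mathcal A_2,\dots)$ be an ESA. For $l\ge 1$ put $$F_l(x,y)=\sum_{n\ge d\ge l}f_{d,l}(\mathcal A_n)\,x^{n-d}\frac{y^n}{n!},\qquad F(x,y)=\sum_{l\ge 1}F_l(x,y).$$ Then, as formal power series in $y$ with coefficients in $\mathbb Q[x,t]$, $$1+\sum_{n\ge 1}w(\mathcal A_n,x,t)\frac{y^n}{n!}=\bigl(1-F_1(-x,-y)\bigr)^{t}=\bigl(1+F(-x,-y)\bigr)^{-t},$$ where, for a power series $G$ in $y$ without constant term and $s\in\mathbb Q[x,t]$, $(1+G)^s=\sum_{k\ge 0}\binom{s}{k}G^k$. -/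

import Mathlib

noncomputable section

namespace LevelFaces

/-- The Euclidean space `ℝⁿ`. -/
abbrev E (n : ℕ) : Type := EuclideanSpace ℝ (Fin n)

/-- A finite arrangement of affine subspaces of `ℝⁿ` (below, always of hyperplanes). -/
abbrev Arrangement (n : ℕ) : Type := Finset (AffineSubspace ℝ (E n))

open Classical in
/-- The nonempty intersections of members of `A`; the empty intersection is `ℝⁿ` itself. -/
def flats {n : ℕ} (A : Arrangement n) : Finset (AffineSubspace ℝ (E n)) :=
  (A.powerset.image fun B => B.inf id).filter fun X => X ≠ ⊥

/-- The intersection poset `L(A)`: nonempty intersections, ordered by reverse inclusion. -/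
abbrev IntersectionPoset {n : ℕ} (A : Arrangement n) : Type := (↥(flats A))ᵒᵈ

/-- The affine subspace of `ℝⁿ` underlying an element of `L(A)`. -/
def IntersectionPoset.flat {n : ℕ} {A : Arrangement n} (X : IntersectionPoset A) :
    AffineSubspace ℝ (E n) :=
  (OrderDual.ofDual X : ↥(flats A)).1

/-- The dimension of an element of `L(A)`. -/
def IntersectionPoset.dim {n : ℕ} {A : Arrangement n} (X : IntersectionPoset A) : ℕ :=
  Module.finrank ℝ X.flat.direction

open Classical in
instance {n : ℕ} (A : Arrangement n) : LocallyFiniteOrder (IntersectionPoset A) :=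
  Fintype.toLocallyFiniteOrder

/-- The polynomial ring `ℚ[x, t]`. -/
abbrev Pol : Type := MvPolynomial (Fin 2) ℚ

/-- The indeterminate `x`. -/
def xVar : Pol := MvPolynomial.X 0

/-- The indeterminate `t`. -/
def tVar : Pol := MvPolynomial.X 1

open Classical in
/-- The Whitney polynomial `w(A, x, t) = ∑_{X ≤ Y} μ(X, Y) x^{n - dim X} t^{dim Y}`. -/
def whitney {n : ℕ} (A : Arrangement n) : Pol :=
  ∑ X : IntersectionPoset A, ∑ Y : IntersectionPoset A with X ≤ Y,
    MvPolynomial.C (IncidenceAlgebra.mu ℚ X Y) * xVar ^ (n - X.dim) * tVar ^ Y.dim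

/-- The hyperplane `x_i - x_j = c` of `ℝⁿ` (for `i ≠ j`). -/
def braidHyperplane {n : ℕ} (i j : Fin n) (c : ℝ) : AffineSubspace ℝ (E n) where
  carrier := {v | v i - v j = c}
  smul_vsub_vadd_mem' := by
    intro r p q s hp hq hs
    simp only [Set.mem_ofPred_eq, vsub_eq_sub, vadd_eq_add, PiLp.add_apply, PiLp.smul_apply,
      PiLp.sub_apply, smul_eq_mul] at *
    linear_combination r * hp - r * hq + hs

/-- Deformed braid arrangements: for each pair `i < j`, a nonempty finite set `a i j` of
right-hand sides `c` of equations `x_i - x_j = c`. -/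
def IsDeformedBraid {n : ℕ} (A : Arrangement n) : Prop :=
  ∃ a : Fin n → Fin n → Finset ℝ, (∀ i j, i < j → (a i j).Nonempty) ∧
    ∀ H, H ∈ A ↔ ∃ i j, i < j ∧ ∃ c ∈ a i j, H = braidHyperplane i j c

open Classical in
/-- The subarrangement `A^S` of the hyperplanes parallel to `x_i - x_j = 0` for some distinct
`i, j ∈ S`. -/
def subArr {n : ℕ} (A : Arrangement n) (S : Finset (Fin n)) : Arrangement n :=
  A.filter fun H => ∃ i ∈ S, ∃ j ∈ S, i ≠ j ∧ H.Parallel (braidHyperplane i j 0)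

/-- Exponential sequences of arrangements `(A 1, A 2, …)`; the value `A 0` plays no role. -/
structure IsESA (A : ∀ n : ℕ, Arrangement n) : Prop where
  deformedBraid : ∀ n, 1 ≤ n → IsDeformedBraid (A n)
  iso : ∀ n, 1 ≤ n → ∀ S : Finset (Fin n), S.Nonempty →
    Nonempty (IntersectionPoset (subArr (A n) S) ≃o IntersectionPoset (A S.card))

/-- The complement in the flat `X` of the members of `A` that do not contain `X`. -/
def complement {n : ℕ} (A : Arrangement n) (X : AffineSubspace ℝ (E n)) : Set (E n) :=
  (X : Set (E n)) \ ⋃ H ∈ A, ⋃ (_ : ¬ X ≤ H), (H : Set (E n))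

/-- The faces of `A`: the connected components of the complements in the flats of `A`. -/
def faces {n : ℕ} (A : Arrangement n) : Set (Set (E n)) :=
  {F | ∃ X ∈ flats A, ∃ p ∈ complement A X, F = connectedComponentIn (complement A X) p}

/-- The dimension of a face: the dimension of its affine hull. -/
def faceDim {n : ℕ} (F : Set (E n)) : ℕ := Module.finrank ℝ (affineSpan ℝ F).direction

/-- The level of a subset of `ℝⁿ`: the least dimension of a linear subspace `W` such that the
distances from the points of the set to `W` are uniformly bounded. -/
def level {n : ℕ} (F : Set (E n)) : ℕ :=
  sInf {k | ∃ W : Submodule ℝ (E n), Module.finrank ℝ W = k ∧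
    ∃ r : ℝ, 0 < r ∧ ∀ v ∈ F, Metric.infDist v (W : Set (E n)) ≤ r}

/-- `f_{d,l}(A)`: the number of faces of dimension `d` and level `l`. -/
def faceCount {n : ℕ} (A : Arrangement n) (d l : ℕ) : ℕ :=
  {F | F ∈ faces A ∧ faceDim F = d ∧ level F = l}.ncard

/-- `F_l(x, y) = ∑_{n ≥ d ≥ l} f_{d,l}(A_n) x^{n-d} yⁿ / n!`, a power series in `y` over
`ℚ[x, t]`. -/
def levelGF (A : ∀ n : ℕ, Arrangement n) (l : ℕ) : PowerSeries Pol :=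
  PowerSeries.mk fun n => MvPolynomial.C ((n.factorial : ℚ)⁻¹) *
    ∑ d ∈ Finset.Icc l n, (faceCount (A n) d l : Pol) * xVar ^ (n - d)

theorem coeff_levelGF_of_lt (A : ∀ n : ℕ, Arrangement n) {l n : ℕ} (h : n < l) :
    PowerSeries.coeff n (levelGF A l) = 0 := by
  simp [levelGF, Finset.Icc_eq_empty_of_lt h]

/-- `F(x, y) = ∑_{l ≥ 1} F_l(x, y)`: only the terms with `l ≤ n` contribute to the coefficient
of `yⁿ`, see `coeff_levelGF_of_lt`. -/
def totalGF (A : ∀ n : ℕ, Arrangement n) : PowerSeries Pol :=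
  PowerSeries.mk fun n => ∑ l ∈ Finset.Icc 1 n, PowerSeries.coeff n (levelGF A l)

/-- `G(x, y) ↦ G(-x, -y)`. -/
def negArgs (G : PowerSeries Pol) : PowerSeries Pol :=
  PowerSeries.rescale (-1)
    (PowerSeries.map (MvPolynomial.aeval ![-xVar, tVar] : Pol →ₐ[ℚ] Pol).toRingHom G)

/-- The formal power `H ^ s = ∑_k binom(s, k) (H - 1) ^ k` of a power series `H` in `y` with
constant coefficient `1` and exponent `s ∈ ℚ[x, t]`. -/
def formalPow (H : PowerSeries Pol) (s : Pol) : PowerSeries Pol :=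
  (PowerSeries.binomialSeries Pol s).subst (H - 1)

/-- The exponential generating function `1 + ∑_{n ≥ 1} w(A_n, x, t) yⁿ / n!`. -/
def whitneyGF (A : ∀ n : ℕ, Arrangement n) : PowerSeries Pol :=
  1 + PowerSeries.mk fun n =>
    if n = 0 then 0 else MvPolynomial.C ((n.factorial : ℚ)⁻¹) * whitney (A n)

end LevelFaces

end

/-!
Every arrangement here is the set of solution hyperplanes of a finite system `K` of equations
`x_i - x_j = c`, and its faces correspond to the realizable sign vectors (`covectors K`,
`faces_arr`) of the defects `p_i - p_j - c`. Let `phi K z` be the sum of `z ^ codim F` over the faces `F`.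

*The Whitney polynomial.* By Möbius inversion (`sum_mu_mul`), the inner sum over `Y` in the Whitney
polynomial at `t = -q` is the unique function `g` on flats with `∑_{Y ⊆ X} g Y = (-q) ^ dim X`.
Such a function can be written down: sum over all colourings of the coordinates with `q` colours,
and count with the sign `(-1) ^ dim` the faces with affine hull `Y` of the subarrangement of the
hyperplanes `x_i - x_j = c` with `i` and `j` of the same colour (`sum_colourSum`). This rests on
the Euler relation `euler_relation`, that the sum of `(-1) ^ dim` over the faces inside a flat is
`(-1) ^ dim` of the flat, because a new hyperplane either misses the relative interior of a face,
contains the face, or cuts it in three; and on the fact that `X` is a flat of exactly those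
subarrangements whose colouring is constant on the components of `X`, of which there are
`q ^ dim X`. The arrangement of a colouring is a product over the colours, so `eval_whitney` and
`phi_monochromatic` express `w (A, x, -q)` through the polynomials `phi` of the subarrangements on
sets of coordinates. By Möbius inversion again, these depend only on the intersection posets
(`phi_eq_of_orderIso`), hence, for an exponential sequence, on the numbers of coordinates. If `Φ`
denotes the exponential generating function of the `phi (K n) (-x)`, then the generating function
of the Whitney polynomials at `t = -q` is `Φ(-y) ^ q`. Polynomials in `t` are determined by their
values at the integers `-q` (`eq_of_evalSeries`).

*The levels.* The recession cone of a face consists of the vectors `v` with `v_i ≥ v_j` whenever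
some hyperplane bounds `x_i - x_j` from below on the face (`Beats`). For every pair `i ≠ j` one of
the inequalities `v_i ≥ v_j` and `v_j ≥ v_i` occurs. So there is a least nonempty set `T` of
coordinates that no coordinate outside `T` beats (`existsUnique_dominant`), and the face is the
product, up to translating the coordinates in `T` upwards, of an arbitrary face in the coordinates
outside `T` and of a face in the coordinates in `T` with bounded coordinate differences, that is,
of level one (`level_eq_one_iff`). This gives the recursion `phi_within_eq_sum`, which says that
the generating function `Γ` of the faces of level one satisfies `Φ = 1 + Γ * Φ`. As all levels lie
between `1` and `n`, the series `1 + F(-x, -y)` is `Φ(-y)`, and `1 - F_1(-x, -y)` is its inverse.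
-/

noncomputable section

namespace LevelFaces

open scoped Classical

variable {n : ℕ}

/-! ### Sign vectors of systems of difference equations -/

/-- The equation `x_i - x_j = c` in `ℝⁿ`, encoded as the triple `(i, j, c)`. -/
abbrev DiffEq (n : ℕ) : Type := Fin n × Fin n × ℝ

/-- The defect `p_i - p_j - c` of a point `p` in the equation `x_i - x_j = c`. -/
def defect (k : DiffEq n) (p : E n) : ℝ := p k.1 - p k.2.1 - k.2.2

/-- The normal vector `e_i - e_j` of the equation `x_i - x_j = c`. -/
def edge (k : DiffEq n) : E n := EuclideanSpace.single k.1 1 - EuclideanSpace.single k.2.1 1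

theorem inner_edge (k : DiffEq n) (v : E n) : inner ℝ (edge k) v = v k.1 - v k.2.1 := by
  simp [edge, inner_sub_left, EuclideanSpace.inner_single_left]

theorem defect_add (k : DiffEq n) (p v : E n) :
    defect k (p + v) = defect k p + (v k.1 - v k.2.1) := by
  simp only [defect, PiLp.add_apply]; ring

theorem defect_add_smul (k : DiffEq n) (p v : E n) (t : ℝ) :
    defect k (p + t • v) = defect k p + t * (v k.1 - v k.2.1) := by
  simp only [defect_add, PiLp.smul_apply, smul_eq_mul]; ring

theorem defect_sub_defect (k : DiffEq n) (p q : E n) :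
    defect k q - defect k p = (q - p) k.1 - (q - p) k.2.1 := by
  simp only [defect, PiLp.sub_apply]; ring

theorem continuous_defect (k : DiffEq n) : Continuous (defect k) := by
  unfold defect; fun_prop

/-- The linear span of the normal vectors of a system of difference equations. -/
def edgeSpan (B : Finset (DiffEq n)) : Submodule ℝ (E n) :=
  Submodule.span ℝ (edge '' (B : Set (DiffEq n)))

/-- The rank of a system of difference equations: the codimension of its solution set, when that
is nonempty. -/
def rk (B : Finset (DiffEq n)) : ℕ := Module.finrank ℝ (edgeSpan B)

theorem edge_mem_edgeSpan {B : Finset (DiffEq n)} {k : DiffEq n} (h : k ∈ B) :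
    edge k ∈ edgeSpan B :=
  Submodule.subset_span ⟨k, by exact_mod_cast h, rfl⟩

theorem mem_edgeSpan_orthogonal {B : Finset (DiffEq n)} {v : E n} :
    v ∈ (edgeSpan B)ᗮ ↔ ∀ k ∈ B, v k.1 = v k.2.1 := by
  constructor
  · intro h k hk
    have := (Submodule.mem_orthogonal _ _).1 h _ (edge_mem_edgeSpan hk)
    rw [inner_edge] at this
    linarith
  · intro h
    rw [Submodule.mem_orthogonal']
    intro u hu
    induction hu using Submodule.span_induction with
    | mem x hx =>
      obtain ⟨k, hk, rfl⟩ := hx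
      rw [real_inner_comm, inner_edge, h k (by exact_mod_cast hk), sub_self]
    | zero => simp
    | add x y _ _ hx hy => rw [inner_add_right, hx, hy, add_zero]
    | smul a x _ hx => rw [inner_smul_right, hx, mul_zero]

theorem edge_mem_edgeSpan_iff {B : Finset (DiffEq n)} {k : DiffEq n} :
    edge k ∈ edgeSpan B ↔ ∀ v : E n, (∀ b ∈ B, v b.1 = v b.2.1) → v k.1 = v k.2.1 := by
  rw [← Submodule.orthogonal_orthogonal (edgeSpan B), Submodule.mem_orthogonal]
  refine forall_congr' fun v => ?_
  rw [mem_edgeSpan_orthogonal, real_inner_comm, inner_edge, sub_eq_zero]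

theorem finrank_orthogonal_edgeSpan (B : Finset (DiffEq n)) :
    Module.finrank ℝ (edgeSpan B)ᗮ = n - rk B := by
  have := Submodule.finrank_add_finrank_orthogonal (edgeSpan B)
  rw [finrank_euclideanSpace_fin] at this
  unfold rk; omega

theorem rk_le (B : Finset (DiffEq n)) : rk B ≤ n := by
  have := Submodule.finrank_le (edgeSpan B)
  rwa [finrank_euclideanSpace_fin] at this

@[simp] theorem rk_empty : rk (∅ : Finset (DiffEq n)) = 0 := by
  rw [rk, edgeSpan, Finset.coe_empty, Set.image_empty, Submodule.span_empty, finrank_bot]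

theorem edgeSpan_insert (k : DiffEq n) (B : Finset (DiffEq n)) :
    edgeSpan (insert k B) = Submodule.span ℝ {edge k} ⊔ edgeSpan B := by
  simp [edgeSpan, Set.image_insert_eq, Submodule.span_insert]

theorem edgeSpan_union (B C : Finset (DiffEq n)) :
    edgeSpan (B ∪ C) = edgeSpan B ⊔ edgeSpan C := by
  simp [edgeSpan, Set.image_union, Submodule.span_union]

theorem rk_insert_of_mem {k : DiffEq n} {B : Finset (DiffEq n)} (h : edge k ∈ edgeSpan B) :
    rk (insert k B) = rk B := by
  unfold rk
  rw [edgeSpan_insert, sup_eq_right.2 (by simpa using h)]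

theorem rk_insert_of_notMem {k : DiffEq n} {B : Finset (DiffEq n)} (h : edge k ∉ edgeSpan B) :
    rk (insert k B) = rk B + 1 := by
  unfold rk
  have h0 : edge k ≠ 0 := fun h' => h (h' ▸ Submodule.zero_mem _)
  have hd : Submodule.span ℝ {edge k} ⊓ edgeSpan B = ⊥ := by
    rw [← disjoint_iff, disjoint_comm, Submodule.disjoint_span_singleton' h0]
    exact h
  have := Submodule.finrank_sup_add_finrank_inf_eq (Submodule.span ℝ {edge k}) (edgeSpan B)
  rw [hd, finrank_bot, finrank_span_singleton h0] at this
  rw [edgeSpan_insert]; omega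

/-- Ranks add up over systems that involve disjoint sets of coordinates. -/
theorem rk_union {B C : Finset (DiffEq n)} (T : Finset (Fin n))
    (hB : ∀ k ∈ B, k.1 ∈ T ∧ k.2.1 ∈ T) (hC : ∀ k ∈ C, k.1 ∉ T ∧ k.2.1 ∉ T) :
    rk (B ∪ C) = rk B + rk C := by
  have hd : edgeSpan B ⊓ edgeSpan C = ⊥ := by
    rw [eq_bot_iff]
    rintro x ⟨hx, hx'⟩
    have h1 : ∀ i ∉ T, x i = 0 := by
      intro i hi
      have : edgeSpan B ≤
          LinearMap.ker (EuclideanSpace.proj (𝕜 := ℝ) i : E n →L[ℝ] ℝ).toLinearMap := by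
        refine Submodule.span_le.2 ?_
        rintro _ ⟨k, hk, rfl⟩
        have := hB k (by exact_mod_cast hk)
        have h1 : i ≠ k.1 := fun h => hi (h ▸ this.1)
        have h2 : i ≠ k.2.1 := fun h => hi (h ▸ this.2)
        simp [edge, h1, h2]
      simpa using this hx
    have h2 : ∀ i ∈ T, x i = 0 := by
      intro i hi
      have : edgeSpan C ≤
          LinearMap.ker (EuclideanSpace.proj (𝕜 := ℝ) i : E n →L[ℝ] ℝ).toLinearMap := by
        refine Submodule.span_le.2 ?_
        rintro _ ⟨k, hk, rfl⟩
        have := hC k (by exact_mod_cast hk)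
        have h1 : i ≠ k.1 := fun h => this.1 (h ▸ hi)
        have h2 : i ≠ k.2.1 := fun h => this.2 (h ▸ hi)
        simp [edge, h1, h2]
      simpa using this hx'
    rw [Submodule.mem_bot]
    ext i
    by_cases hi : i ∈ T
    · exact h2 i hi
    · exact h1 i hi
  have := Submodule.finrank_sup_add_finrank_inf_eq (edgeSpan B) (edgeSpan C)
  rw [hd, finrank_bot] at this
  unfold rk
  rw [edgeSpan_union]; omega

/-- The restriction of a sign vector to a system `K`, extended by zero. -/
def restrict (K : Finset (DiffEq n)) (σ : DiffEq n → SignType) : DiffEq n → SignType :=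
  fun k => if k ∈ K then σ k else 0

theorem restrict_of_mem {K : Finset (DiffEq n)} {σ : DiffEq n → SignType} {k : DiffEq n}
    (h : k ∈ K) : restrict K σ k = σ k := if_pos h

theorem restrict_of_notMem {K : Finset (DiffEq n)} {σ : DiffEq n → SignType} {k : DiffEq n}
    (h : k ∉ K) : restrict K σ k = 0 := if_neg h

/-- The sign vector of a point with respect to the system `K`; it vanishes outside `K`. -/
def signs (K : Finset (DiffEq n)) (p : E n) : DiffEq n → SignType :=
  restrict K fun k => SignType.sign (defect k p)

theorem signs_of_mem {K : Finset (DiffEq n)} {k : DiffEq n} (h : k ∈ K) (p : E n) :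
    signs K p k = SignType.sign (defect k p) := restrict_of_mem h

theorem signs_of_notMem {K : Finset (DiffEq n)} {k : DiffEq n} (h : k ∉ K) (p : E n) :
    signs K p k = 0 := restrict_of_notMem h

theorem restrict_signs {K L : Finset (DiffEq n)} (h : K ⊆ L) (p : E n) :
    restrict K (signs L p) = signs K p := by
  funext k
  by_cases hk : k ∈ K
  · rw [restrict_of_mem hk, signs_of_mem hk, signs_of_mem (h hk)]
  · rw [restrict_of_notMem hk, signs_of_notMem hk]

theorem signs_eq_signs_iff {K : Finset (DiffEq n)} {p q : E n} :
    signs K p = signs K q ↔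
      ∀ k ∈ K, SignType.sign (defect k p) = SignType.sign (defect k q) := by
  constructor
  · intro h k hk
    rw [← signs_of_mem hk, h, signs_of_mem hk]
  · intro h
    funext k
    by_cases hk : k ∈ K
    · rw [signs_of_mem hk, signs_of_mem hk, h k hk]
    · rw [signs_of_notMem hk, signs_of_notMem hk]

theorem finite_range_signs (K : Finset (DiffEq n)) : (Set.range (signs K)).Finite := by
  refine Set.Finite.of_injOn (f := fun σ (k : K) => σ k) (t := Set.univ)
    (fun _ _ => Set.mem_univ _) ?_ Set.finite_univ
  rintro _ ⟨p, rfl⟩ _ ⟨q, rfl⟩ h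
  rw [signs_eq_signs_iff]
  intro k hk
  have := congrFun h ⟨k, hk⟩
  simpa only [signs_of_mem hk] using this

/-- The realizable sign vectors of the system `K`; they correspond to the faces of the arrangement
of the solution hyperplanes of `K`. -/
def covectors (K : Finset (DiffEq n)) : Finset (DiffEq n → SignType) :=
  (finite_range_signs K).toFinset

@[simp] theorem mem_covectors {K : Finset (DiffEq n)} {σ : DiffEq n → SignType} :
    σ ∈ covectors K ↔ ∃ p, signs K p = σ := by
  simp [covectors]

/-- The equations of `K` that hold on the cell of the sign vector `σ`. -/
def zeros (K : Finset (DiffEq n)) (σ : DiffEq n → SignType) : Finset (DiffEq n) :=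
  K.filter fun k => σ k = 0

@[simp] theorem mem_zeros {K : Finset (DiffEq n)} {σ : DiffEq n → SignType} {k : DiffEq n} :
    k ∈ zeros K σ ↔ k ∈ K ∧ σ k = 0 := by
  simp [zeros]

theorem mem_zeros_signs {K : Finset (DiffEq n)} {p : E n} {k : DiffEq n} :
    k ∈ zeros K (signs K p) ↔ k ∈ K ∧ defect k p = 0 := by
  rw [mem_zeros]
  refine and_congr_right fun hk => ?_
  rw [signs_of_mem hk, sign_eq_zero_iff]

/-- Two points with the same sign vector differ by a vector of the direction of the cell. -/
theorem sub_mem_orthogonal_of_signs_eq {K : Finset (DiffEq n)} {p q : E n}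
    (h : signs K q = signs K p) : q - p ∈ (edgeSpan (zeros K (signs K p)))ᗮ := by
  rw [mem_edgeSpan_orthogonal]
  intro k hk
  have h1 := (mem_zeros_signs.1 hk).2
  have h2 : defect k q = 0 := (mem_zeros_signs.1 (h ▸ hk : k ∈ zeros K (signs K q))).2
  have := defect_sub_defect k p q
  linarith

/-- A cell is relatively open: small moves along its direction do not leave it. -/
theorem eventually_signs_add_smul {K : Finset (DiffEq n)} {p v : E n}
    (hv : v ∈ (edgeSpan (zeros K (signs K p)))ᗮ) :
    ∀ᶠ t : ℝ in nhds 0, signs K (p + t • v) = signs K p := by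
  simp only [signs_eq_signs_iff]
  rw [Filter.eventually_all_finset]
  intro k hk
  rw [mem_edgeSpan_orthogonal] at hv
  have hc : Continuous fun t : ℝ => defect k (p + t • v) :=
    (continuous_defect k).comp (by fun_prop)
  have h0 : defect k (p + (0 : ℝ) • v) = defect k p := by simp
  rcases lt_trichotomy (defect k p) 0 with h | h | h
  · have := hc.continuousAt.eventually_lt (x₀ := 0) continuousAt_const (h0 ▸ h)
    filter_upwards [this] with t ht
    rw [sign_neg ht, sign_neg h]
  · refine Filter.Eventually.of_forall fun t => ?_
    rw [defect_add_smul, hv k (mem_zeros_signs.2 ⟨hk, h⟩), sub_self, mul_zero, add_zero]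
  · have := continuousAt_const.eventually_lt (x₀ := (0 : ℝ)) hc.continuousAt (h0 ▸ h)
    filter_upwards [this] with t ht
    rw [sign_pos ht, sign_pos h]

theorem exists_pos_signs_add_smul {K : Finset (DiffEq n)} {p v : E n}
    (hv : v ∈ (edgeSpan (zeros K (signs K p)))ᗮ) :
    ∃ t : ℝ, 0 < t ∧ signs K (p + t • v) = signs K p ∧ signs K (p + (-t) • v) = signs K p := by
  obtain ⟨ε, hε, h⟩ := Metric.eventually_nhds_iff.1 (eventually_signs_add_smul hv)
  refine ⟨ε / 2, by positivity, h ?_, h ?_⟩ <;>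
    simp [abs_of_pos hε, hε]

theorem sign_defect_segment {k : DiffEq n} {p q : E n} {s : SignType}
    (hp : SignType.sign (defect k p) = s) (hq : SignType.sign (defect k q) = s) {t : ℝ}
    (h0 : 0 ≤ t) (h1 : t ≤ 1) : SignType.sign (defect k (p + t • (q - p))) = s := by
  have e : defect k (p + t • (q - p)) = (1 - t) * defect k p + t * defect k q := by
    rw [defect_add_smul, ← defect_sub_defect]; ring
  rw [e]
  rcases eq_or_lt_of_le h0 with rfl | h0
  · simpa using hp
  cases s with
  | zero =>
    rw [SignType.zero_eq_zero, sign_eq_zero_iff] at *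
    rw [hp, hq]; ring
  | neg =>
    rw [SignType.neg_eq_neg_one, sign_eq_neg_one_iff] at *
    nlinarith [mul_pos h0 (neg_pos.2 hq), mul_nonneg (sub_nonneg.2 h1) (neg_pos.2 hp).le]
  | pos =>
    rw [SignType.pos_eq_one, sign_eq_one_iff] at *
    nlinarith [mul_pos h0 hq, mul_nonneg (sub_nonneg.2 h1) hp.le]

/-- Cells are convex. -/
theorem signs_segment {K : Finset (DiffEq n)} {p q : E n} {σ : DiffEq n → SignType}
    (hp : signs K p = σ) (hq : signs K q = σ) {t : ℝ} (h0 : 0 ≤ t) (h1 : t ≤ 1) :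
    signs K (p + t • (q - p)) = σ := by
  subst hp
  rw [signs_eq_signs_iff] at *
  exact fun k hk => sign_defect_segment rfl (hq k hk) h0 h1

/-! ### The Euler relation -/

/-- The signs that the defect in the equation `k` takes on the cell of `σ`. -/
def newSigns (K : Finset (DiffEq n)) (k : DiffEq n) (σ : DiffEq n → SignType) : Finset SignType :=
  Finset.univ.filter fun s => ∃ p, signs K p = σ ∧ SignType.sign (defect k p) = s

theorem signs_insert {K : Finset (DiffEq n)} {k : DiffEq n} (p : E n) :
    signs (insert k K) p = Function.update (signs K p) k (SignType.sign (defect k p)) := by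
  funext l
  by_cases hl : l = k
  · subst hl; simp [signs_of_mem]
  · rw [Function.update_of_ne hl]
    by_cases h : l ∈ K
    · rw [signs_of_mem h, signs_of_mem (Finset.mem_insert_of_mem h)]
    · rw [signs_of_notMem h, signs_of_notMem (by simp [h, hl])]

theorem zeros_insert_update {K : Finset (DiffEq n)} {k : DiffEq n} (hk : k ∉ K)
    (σ : DiffEq n → SignType) (s : SignType) :
    zeros (insert k K) (Function.update σ k s) =
      if s = 0 then insert k (zeros K σ) else zeros K σ := by
  ext l
  by_cases hl : l = k
  · subst hl; split_ifs with h <;> simp [h, hk]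
  · split_ifs with h <;> simp [hl]

/-- A new hyperplane either leaves a cell alone or cuts it in three, which does not change the
sum of `(-1) ^ codim` over the cells. -/
theorem sum_newSigns {K : Finset (DiffEq n)} {k : DiffEq n} (hk : k ∉ K)
    {σ : DiffEq n → SignType} (hσ : σ ∈ covectors K) :
    ∑ s ∈ newSigns K k σ, (-1 : ℚ) ^ rk (zeros (insert k K) (Function.update σ k s)) =
      (-1) ^ rk (zeros K σ) := by
  simp only [zeros_insert_update hk]
  obtain ⟨p, hp⟩ := mem_covectors.1 hσ
  by_cases hmem : edge k ∈ edgeSpan (zeros K σ)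
  · have hns : newSigns K k σ = {SignType.sign (defect k p)} := by
      ext s
      simp only [newSigns, Finset.mem_filter, Finset.mem_univ, true_and, Finset.mem_singleton]
      constructor
      · rintro ⟨q, hq, rfl⟩
        have h1 := sub_mem_orthogonal_of_signs_eq (hq.trans hp.symm)
        rw [hp, mem_edgeSpan_orthogonal] at h1
        have h2 := edge_mem_edgeSpan_iff.1 hmem _ h1
        have h3 := defect_sub_defect k p q
        rw [show defect k q = defect k p by linarith]
      · rintro rfl
        exact ⟨p, hp, rfl⟩
    rw [hns, Finset.sum_singleton]
    split_ifs
    · rw [rk_insert_of_mem hmem]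
    · rfl
  · by_cases h0 : (0 : SignType) ∈ newSigns K k σ
    · have hns : newSigns K k σ = Finset.univ := by
        simp only [newSigns, Finset.mem_filter, Finset.mem_univ, true_and] at h0
        obtain ⟨q, hq, hq0⟩ := h0
        rw [sign_eq_zero_iff] at hq0
        rw [edge_mem_edgeSpan_iff] at hmem
        push Not at hmem
        obtain ⟨v, hv, hvk⟩ := hmem
        rw [← mem_edgeSpan_orthogonal, ← hq] at hv
        obtain ⟨t, ht, h1, h2⟩ := exists_pos_signs_add_smul hv
        rw [hq] at h1 h2
        have d1 := defect_add_smul k q v t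
        have d2 := defect_add_smul k q v (-t)
        rw [hq0, zero_add] at d1 d2
        ext s
        simp only [newSigns, Finset.mem_filter, Finset.mem_univ, true_and, iff_true]
        have hc : v k.1 - v k.2.1 ≠ 0 := sub_ne_zero.2 hvk
        rcases lt_or_gt_of_ne hc with hc | hc
        · cases s with
          | zero => exact ⟨q, hq, by rw [hq0]; simp⟩
          | neg => exact ⟨_, h1, by rw [d1, sign_neg (mul_neg_of_pos_of_neg ht hc)]; rfl⟩
          | pos => exact ⟨_, h2, by rw [d2, sign_pos (by nlinarith)]; rfl⟩
        · cases s with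
          | zero => exact ⟨q, hq, by rw [hq0]; simp⟩
          | neg => exact ⟨_, h2, by rw [d2, sign_neg (by nlinarith)]; rfl⟩
          | pos => exact ⟨_, h1, by rw [d1, sign_pos (mul_pos ht hc)]; rfl⟩
      have hu : (Finset.univ : Finset SignType) = {0, -1, 1} := rfl
      rw [hns, hu, Finset.sum_insert (by decide), Finset.sum_insert (by decide),
        Finset.sum_singleton, if_pos rfl, if_neg (by decide), if_neg (by decide),
        rk_insert_of_notMem hmem]
      ring
    · -- By convexity of the cell, the signs `1` and `-1` together would force the sign `0`.
      have hns : newSigns K k σ = {SignType.sign (defect k p)} := by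
        ext s
        simp only [newSigns, Finset.mem_filter, Finset.mem_univ, true_and,
          Finset.mem_singleton] at h0 ⊢
        constructor
        · rintro ⟨q, hq, rfl⟩
          by_contra hne
          apply h0
          have hd : defect k p - defect k q ≠ 0 := by
            intro h
            exact hne (by rw [sub_eq_zero.1 h])
          have hmul : defect k p * defect k q < 0 := by
            have hp0 : defect k p ≠ 0 := fun h => h0 ⟨p, hp, by rw [h]; simp⟩
            have hq0 : defect k q ≠ 0 := fun h => h0 ⟨q, hq, by rw [h]; simp⟩
            rcases lt_or_gt_of_ne hp0 with h | h <;> rcases lt_or_gt_of_ne hq0 with h' | h'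
            · exact absurd (by rw [sign_neg h, sign_neg h']) hne
            · exact mul_neg_of_neg_of_pos h h'
            · exact mul_neg_of_pos_of_neg h h'
            · exact absurd (by rw [sign_pos h, sign_pos h']) hne
          have hsq : 0 < (defect k p - defect k q) ^ 2 := by positivity
          refine ⟨_, signs_segment hp hq
            (t := defect k p * (defect k p - defect k q) / (defect k p - defect k q) ^ 2) ?_ ?_, ?_⟩
          · apply div_nonneg _ hsq.le
            nlinarith [sq_nonneg (defect k p)]
          · rw [div_le_one hsq]
            nlinarith [sq_nonneg (defect k q)]
          · rw [defect_add_smul, ← defect_sub_defect, sign_eq_zero_iff]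
            field_simp
            ring
        · rintro rfl
          exact ⟨p, hp, rfl⟩
      have hne : SignType.sign (defect k p) ≠ 0 := by
        intro h
        rw [hns, Finset.mem_singleton] at h0
        exact h0 h.symm
      rw [hns, Finset.sum_singleton, if_neg hne]

theorem filter_covectors_insert (K : Finset (DiffEq n)) (k : DiffEq n)
    (σ : DiffEq n → SignType) :
    (covectors (insert k K)).filter (fun τ => restrict K τ = σ) =
      (newSigns K k σ).image (Function.update σ k) := by
  ext τ
  simp only [Finset.mem_filter, mem_covectors, Finset.mem_image, newSigns, Finset.mem_univ,
    true_and]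
  constructor
  · rintro ⟨⟨p, rfl⟩, h⟩
    rw [restrict_signs (Finset.subset_insert _ _)] at h
    exact ⟨_, ⟨p, h, rfl⟩, by rw [signs_insert, h]⟩
  · rintro ⟨s, ⟨p, rfl, rfl⟩, rfl⟩
    rw [← signs_insert]
    exact ⟨⟨p, rfl⟩, restrict_signs (Finset.subset_insert _ _) p⟩

/-- The Euler relation for the cells inside a flat: the sum of `(-1) ^ codim` over the
cells that satisfy the equations in `B` is `(-1) ^ codim` of the solution set of `B`. -/
theorem euler_relation {B K : Finset (DiffEq n)} (hBK : B ⊆ K)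
    (hB : ∃ p : E n, ∀ k ∈ B, defect k p = 0) :
    ∑ σ ∈ (covectors K).filter (fun σ => ∀ k ∈ B, σ k = 0), (-1 : ℚ) ^ rk (zeros K σ) =
      (-1) ^ rk B := by
  obtain ⟨C, hC, rfl⟩ : ∃ C, Disjoint B C ∧ K = B ∪ C :=
    ⟨K \ B, Finset.disjoint_sdiff, by simp [Finset.union_eq_right.2 hBK]⟩
  clear hBK
  induction C using Finset.induction_on with
  | empty =>
    obtain ⟨p, hp⟩ := hB
    have h0 : ∀ k, signs B p k = 0 := by
      intro k
      by_cases hk : k ∈ B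
      · rw [signs_of_mem hk, hp k hk]; simp
      · exact signs_of_notMem hk p
    rw [Finset.union_empty, Finset.sum_eq_single (signs B p)]
    · congr 2
      ext k
      simp [h0]
    · intro σ hσ hne
      obtain ⟨h1, h2⟩ := Finset.mem_filter.1 hσ
      obtain ⟨q, rfl⟩ := mem_covectors.1 h1
      refine absurd (funext fun k => ?_) hne
      rw [h0]
      by_cases hk : k ∈ B
      · exact h2 k hk
      · exact signs_of_notMem hk q
    · intro h
      exact absurd (Finset.mem_filter.2 ⟨mem_covectors.2 ⟨p, rfl⟩, fun k _ => h0 k⟩) h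
  | insert k C hkC ih =>
    rw [Finset.disjoint_insert_right] at hC
    have hk : k ∉ B ∪ C := by simp [hC.1, hkC]
    rw [← ih hC.2, Finset.union_insert, Finset.sum_filter, Finset.sum_filter,
      ← Finset.sum_fiberwise_of_maps_to (s := covectors (insert k (B ∪ C))) (t := covectors (B ∪ C))
        (g := restrict (B ∪ C))]
    · refine Finset.sum_congr rfl fun σ hσ => ?_
      rw [filter_covectors_insert, Finset.sum_image (fun s _ t _ h => by
        simpa using congrFun h k)]
      have hB' : ∀ s, (∀ l ∈ B, Function.update σ k s l = 0) ↔ ∀ l ∈ B, σ l = 0 := by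
        intro s
        refine forall₂_congr fun l hl => ?_
        rw [Function.update_of_ne (by rintro rfl; exact hC.1 hl)]
      simp only [hB']
      split_ifs
      · exact sum_newSigns hk hσ
      · simp
    · intro τ hτ
      obtain ⟨p, rfl⟩ := mem_covectors.1 hτ
      rw [restrict_signs (Finset.subset_insert _ _)]
      exact mem_covectors.2 ⟨p, rfl⟩

/-! ### Flats and the Möbius function -/

/-- The solution hyperplane of a difference equation (the whole space or the empty set when the
two indices coincide). -/
def hyp (k : DiffEq n) : AffineSubspace ℝ (E n) := braidHyperplane k.1 k.2.1 k.2.2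

theorem mem_hyp {k : DiffEq n} {p : E n} : p ∈ hyp k ↔ defect k p = 0 := by
  change p k.1 - p k.2.1 = k.2.2 ↔ _
  rw [defect, sub_eq_zero]

/-- The arrangement of the solution hyperplanes of a system of difference equations. -/
def arr (K : Finset (DiffEq n)) : Arrangement n := K.image hyp

/-- The solution set of a system of difference equations. -/
def solSpace (B : Finset (DiffEq n)) : AffineSubspace ℝ (E n) := B.inf hyp

theorem mem_solSpace {B : Finset (DiffEq n)} {p : E n} :
    p ∈ solSpace B ↔ ∀ k ∈ B, defect k p = 0 := by
  unfold solSpace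
  induction B using Finset.induction_on with
  | empty => simp
  | insert k B _ ih =>
    rw [Finset.inf_insert, AffineSubspace.mem_inf_iff, ih, mem_hyp, Finset.forall_mem_insert]

theorem solSpace_anti {B C : Finset (DiffEq n)} (h : B ⊆ C) : solSpace C ≤ solSpace B :=
  Finset.inf_mono h

theorem mem_flats {A : Arrangement n} {X : AffineSubspace ℝ (E n)} :
    X ∈ flats A ↔ (∃ B ⊆ A, B.inf id = X) ∧ X ≠ ⊥ := by
  simp [flats]

theorem mem_flats_arr {K : Finset (DiffEq n)} {X : AffineSubspace ℝ (E n)} :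
    X ∈ flats (arr K) ↔ ∃ B ⊆ K, X = solSpace B ∧ ∃ p, p ∈ solSpace B := by
  rw [mem_flats]
  constructor
  · rintro ⟨⟨B, hB, rfl⟩, hne⟩
    obtain ⟨C, hC, rfl⟩ := Finset.subset_image_iff.1 hB
    have h : (C.image hyp).inf id = solSpace C := by
      rw [Finset.inf_image]; rfl
    rw [h] at hne ⊢
    exact ⟨C, by exact_mod_cast hC, rfl, (AffineSubspace.nonempty_iff_ne_bot _).2 hne⟩
  · rintro ⟨B, hB, rfl, hne⟩
    refine ⟨⟨B.image hyp, Finset.image_subset_image hB, ?_⟩,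
      (AffineSubspace.nonempty_iff_ne_bot _).1 hne⟩
    rw [Finset.inf_image]; rfl

theorem mem_solSpace_zeros_signs (K : Finset (DiffEq n)) (p : E n) :
    p ∈ solSpace (zeros K (signs K p)) :=
  mem_solSpace.2 fun _ hk => (mem_zeros_signs.1 hk).2

theorem solSpace_zeros_mem_flats {K L : Finset (DiffEq n)} (h : K ⊆ L) {σ : DiffEq n → SignType}
    (hσ : σ ∈ covectors K) : solSpace (zeros K σ) ∈ flats (arr L) := by
  obtain ⟨p, rfl⟩ := mem_covectors.1 hσ
  exact mem_flats_arr.2 ⟨_, (Finset.filter_subset _ _).trans h, rfl, p,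
    mem_solSpace_zeros_signs K p⟩

theorem direction_solSpace {B : Finset (DiffEq n)} {p : E n} (hp : p ∈ solSpace B) :
    (solSpace B).direction = (edgeSpan B)ᗮ := by
  ext v
  rw [← AffineSubspace.vadd_mem_iff_mem_direction v hp, mem_edgeSpan_orthogonal, mem_solSpace]
  refine forall₂_congr fun k hk => ?_
  rw [vadd_eq_add, add_comm, defect_add, mem_solSpace.1 hp k hk, zero_add, sub_eq_zero]

theorem finrank_direction_solSpace {B : Finset (DiffEq n)} {p : E n} (hp : p ∈ solSpace B) :
    Module.finrank ℝ (solSpace B).direction = n - rk B := by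
  rw [direction_solSpace hp, finrank_orthogonal_edgeSpan]

theorem sub_finrank_direction_solSpace {B : Finset (DiffEq n)} {p : E n} (hp : p ∈ solSpace B) :
    n - Module.finrank ℝ (solSpace B).direction = rk B := by
  rw [finrank_direction_solSpace hp]
  have := rk_le B
  omega

/-- The element of the intersection poset given by a solvable system of equations. -/
def flatMk {K B : Finset (DiffEq n)} (hB : B ⊆ K) (hp : ∃ p, p ∈ solSpace B) :
    IntersectionPoset (arr K) :=
  OrderDual.toDual ⟨solSpace B, mem_flats_arr.2 ⟨B, hB, rfl, hp⟩⟩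

@[simp] theorem flat_flatMk {K B : Finset (DiffEq n)} (hB : B ⊆ K) (hp : ∃ p, p ∈ solSpace B) :
    (flatMk hB hp).flat = solSpace B := rfl

theorem IntersectionPoset.flat_mem {A : Arrangement n} (X : IntersectionPoset A) :
    X.flat ∈ flats A := (OrderDual.ofDual X).2

theorem IntersectionPoset.le_iff {A : Arrangement n} {X Y : IntersectionPoset A} :
    X ≤ Y ↔ Y.flat ≤ X.flat := Iff.rfl

theorem IntersectionPoset.lt_iff {A : Arrangement n} {X Y : IntersectionPoset A} :
    X < Y ↔ Y.flat < X.flat := Iff.rfl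

theorem exists_flatMk {K : Finset (DiffEq n)} (X : IntersectionPoset (arr K)) :
    ∃ (B : Finset (DiffEq n)) (hB : B ⊆ K) (hp : ∃ p, p ∈ solSpace B), X = flatMk hB hp := by
  obtain ⟨B, hB, h, hp⟩ := mem_flats_arr.1 X.flat_mem
  exact ⟨B, hB, hp, OrderDual.ofDual.injective (Subtype.ext h)⟩

theorem IntersectionPoset.dim_le {A : Arrangement n} (X : IntersectionPoset A) : X.dim ≤ n := by
  have := Submodule.finrank_le X.flat.direction
  rwa [finrank_euclideanSpace_fin] at this

/-- The codimension of an element of the intersection poset. -/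
def IntersectionPoset.codim {A : Arrangement n} (X : IntersectionPoset A) : ℕ := n - X.dim

@[simp] theorem codim_flatMk {K B : Finset (DiffEq n)} (hB : B ⊆ K) (hp : ∃ p, p ∈ solSpace B) :
    (flatMk hB hp).codim = rk B :=
  sub_finrank_direction_solSpace hp.choose_spec

theorem IntersectionPoset.codim_lt {A : Arrangement n} {X Y : IntersectionPoset A} (h : X < Y) :
    X.codim < Y.codim := by
  have hne : (Y.flat : Set (E n)).Nonempty :=
    (AffineSubspace.nonempty_iff_ne_bot _).2 (mem_flats.1 Y.flat_mem).2
  have h1 := Submodule.finrank_lt_finrank_of_lt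
    (AffineSubspace.direction_lt_of_nonempty (IntersectionPoset.lt_iff.1 h) hne)
  have h2 := X.dim_le
  unfold codim dim at *
  omega

theorem IntersectionPoset.codim_le {A : Arrangement n} {X Y : IntersectionPoset A} (h : X ≤ Y) :
    X.codim ≤ Y.codim := by
  rcases eq_or_lt_of_le h with rfl | h
  · rfl
  · exact (codim_lt h).le

/-- Strictly monotone maps do not decrease codimensions, because in an intersection poset the
codimension is the length of a longest chain from the bottom. -/
theorem codim_le_of_strictMono {K : Finset (DiffEq n)} {m : ℕ} {A : Arrangement m}
    (f : IntersectionPoset (arr K) → IntersectionPoset A) (hf : StrictMono f)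
    (X : IntersectionPoset (arr K)) : X.codim ≤ (f X).codim := by
  obtain ⟨B, hB, hp, rfl⟩ := exists_flatMk X
  rw [codim_flatMk]
  induction B using Finset.induction_on with
  | empty => simp
  | insert k B _ ih =>
    have hs := Finset.subset_insert k B
    have hp' : ∃ p, p ∈ solSpace B := hp.imp fun p h => solSpace_anti hs h
    have hle : flatMk (hs.trans hB) hp' ≤ flatMk hB hp :=
      IntersectionPoset.le_iff.2 (solSpace_anti hs)
    have ih := ih (hs.trans hB) hp'
    by_cases hk : edge k ∈ edgeSpan B
    · rw [rk_insert_of_mem hk]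
      exact ih.trans (IntersectionPoset.codim_le (hf.monotone hle))
    · have hlt : flatMk (hs.trans hB) hp' < flatMk hB hp := by
        refine lt_of_le_of_ne hle fun h => ?_
        have := congrArg IntersectionPoset.codim h
        rw [codim_flatMk, codim_flatMk, rk_insert_of_notMem hk] at this
        omega
      have := IntersectionPoset.codim_lt (hf hlt)
      rw [rk_insert_of_notMem hk]
      omega

theorem codim_orderIso {K : Finset (DiffEq n)} {m : ℕ} {L : Finset (DiffEq m)}
    (e : IntersectionPoset (arr K) ≃o IntersectionPoset (arr L))
    (X : IntersectionPoset (arr K)) : (e X).codim = X.codim := by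
  refine le_antisymm ?_ (codim_le_of_strictMono e e.strictMono X)
  simpa using codim_le_of_strictMono e.symm e.symm.strictMono (e X)

/-- Möbius inversion from above in a finite poset. -/
theorem sum_mu_mul {α : Type*} [PartialOrder α] [Fintype α] [LocallyFiniteOrder α]
    [DecidableEq α] (f h : α → ℚ) (hf : ∀ x, ∑ y with x ≤ y, f y = h x) (x : α) :
    ∑ y with x ≤ y, IncidenceAlgebra.mu ℚ x y * h y = f x := by
  simp only [← hf, Finset.mul_sum]
  rw [Finset.sum_comm' (s' := fun z => Finset.Icc x z) (t' := Finset.univ.filter (x ≤ ·))]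
  · simp only [← Finset.sum_mul, IncidenceAlgebra.sum_Icc_mu_right, ite_mul, one_mul, zero_mul]
    rw [Finset.sum_ite_eq]
    simp
  · intro y z
    simp only [Finset.mem_filter, Finset.mem_univ, true_and, Finset.mem_Icc]
    exact ⟨fun h => ⟨h, h.1.trans h.2⟩, fun h => h.1⟩

theorem sum_intersectionPoset {A : Arrangement n} (f : AffineSubspace ℝ (E n) → ℚ)
    (X : IntersectionPoset A) :
    ∑ Y : IntersectionPoset A with X ≤ Y, f Y.flat = ∑ Y ∈ flats A with Y ≤ X.flat, f Y := by
  rw [Finset.sum_filter, Finset.sum_filter, ← Finset.sum_coe_sort (flats A)]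
  rfl

theorem sum_univ_intersectionPoset {A : Arrangement n} (f : AffineSubspace ℝ (E n) → ℚ) :
    ∑ Y : IntersectionPoset A, f Y.flat = ∑ Y ∈ flats A, f Y := by
  rw [← Finset.sum_coe_sort (flats A)]
  rfl

/-- The signed number of cells of the system `K` whose affine hull is `X`. -/
def cellSum (K : Finset (DiffEq n)) (X : AffineSubspace ℝ (E n)) : ℚ :=
  ∑ σ ∈ covectors K with solSpace (zeros K σ) = X, (-1) ^ rk (zeros K σ)

theorem solSpace_zeros_le_iff {B K : Finset (DiffEq n)} (hB : B ⊆ K)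
    {σ : DiffEq n → SignType} (hσ : σ ∈ covectors K) :
    solSpace (zeros K σ) ≤ solSpace B ↔ ∀ k ∈ B, σ k = 0 := by
  obtain ⟨p, rfl⟩ := mem_covectors.1 hσ
  constructor
  · intro h k hk
    have := mem_solSpace.1 (h (mem_solSpace_zeros_signs K p)) k hk
    rw [signs_of_mem (hB hk), this, sign_zero]
  · intro h
    exact solSpace_anti fun k hk => mem_zeros.2 ⟨hB hk, h k hk⟩

/-- The Euler relation in terms of affine hulls of cells. -/
theorem sum_cellSum {B K L : Finset (DiffEq n)} (hBK : B ⊆ K) (hKL : K ⊆ L)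
    (hp : ∃ p, p ∈ solSpace B) :
    ∑ Y ∈ flats (arr L) with Y ≤ solSpace B, cellSum K Y = (-1) ^ rk B := by
  unfold cellSum
  rw [← euler_relation hBK (by simpa only [mem_solSpace] using hp)]
  rw [← Finset.sum_fiberwise_of_maps_to (g := fun σ => solSpace (zeros K σ))
    (t := (flats (arr L)).filter (· ≤ solSpace B))]
  · refine Finset.sum_congr rfl fun Y hY => ?_
    refine Finset.sum_congr ?_ fun _ _ => rfl
    ext σ
    simp only [Finset.mem_filter, and_assoc]
    refine and_congr_right fun hσ => ?_
    constructor
    · rintro rfl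
      exact ⟨(solSpace_zeros_le_iff hBK hσ).1 (Finset.mem_filter.1 hY).2, rfl⟩
    · exact fun h => h.2
  · intro σ hσ
    obtain ⟨h1, h2⟩ := Finset.mem_filter.1 hσ
    exact Finset.mem_filter.2
      ⟨solSpace_zeros_mem_flats hKL h1, (solSpace_zeros_le_iff hBK h1).2 h2⟩

/-- Sorting cells by their affine hulls. -/
theorem sum_flats_mul_cellSum {K L : Finset (DiffEq n)} (hKL : K ⊆ L) (b : ℚ) :
    ∑ Y ∈ flats (arr L), b ^ (n - Module.finrank ℝ Y.direction) * cellSum K Y =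
      ∑ σ ∈ covectors K, (-b) ^ rk (zeros K σ) := by
  rw [← Finset.sum_fiberwise_of_maps_to (g := fun σ => solSpace (zeros K σ))
    (t := flats (arr L)) (fun σ hσ => solSpace_zeros_mem_flats hKL hσ)]
  refine Finset.sum_congr rfl fun Y _ => ?_
  rw [cellSum, Finset.mul_sum]
  refine Finset.sum_congr rfl fun σ hσ => ?_
  obtain ⟨h1, rfl⟩ := Finset.mem_filter.1 hσ
  obtain ⟨p, rfl⟩ := mem_covectors.1 h1
  rw [sub_finrank_direction_solSpace (mem_solSpace_zeros_signs K p), ← mul_pow, mul_neg_one]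

/-- The generating polynomial of the cells of the system `K` by codimension. -/
def phi (K : Finset (DiffEq n)) (z : ℚ) : ℚ := ∑ σ ∈ covectors K, z ^ rk (zeros K σ)

/-- The numbers of cells of each dimension depend only on the intersection poset. -/
theorem phi_eq_of_orderIso {K : Finset (DiffEq n)} {m : ℕ} {L : Finset (DiffEq m)}
    (e : IntersectionPoset (arr K) ≃o IntersectionPoset (arr L)) (z : ℚ) : phi K z = phi L z := by
  have key : ∀ {n : ℕ} (K : Finset (DiffEq n)) (X : IntersectionPoset (arr K)),
      ∑ Y with X ≤ Y, cellSum K Y.flat = (-1) ^ X.codim := by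
    intro n K X
    obtain ⟨B, hB, hp, rfl⟩ := exists_flatMk X
    rw [sum_intersectionPoset (cellSum K), flat_flatMk, sum_cellSum hB subset_rfl hp,
      codim_flatMk]
  have hcell : ∀ X, cellSum L (e X).flat = cellSum K X.flat := by
    intro X
    rw [← sum_mu_mul _ _ (key K), ← sum_mu_mul (fun X => cellSum L (e X).flat)]
    intro X
    rw [← codim_orderIso e, ← key L, Finset.sum_filter, Finset.sum_filter,
      ← e.toEquiv.sum_comp]
    simp
  have hphi : ∀ {n : ℕ} (K : Finset (DiffEq n)),
      phi K z = ∑ X : IntersectionPoset (arr K), (-z) ^ X.codim * cellSum K X.flat := by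
    intro n K
    have := sum_flats_mul_cellSum (subset_refl K) (-z)
    rw [neg_neg, ← sum_univ_intersectionPoset
      (fun Y => (-z) ^ (n - Module.finrank ℝ Y.direction) * cellSum K Y)] at this
    exact this.symm
  rw [hphi, hphi, ← e.toEquiv.sum_comp]
  refine Finset.sum_congr rfl fun X _ => ?_
  change _ = (-z) ^ (e X).codim * cellSum L (e X).flat
  rw [codim_orderIso, hcell]

/-! ### Colourings and the values of the Whitney polynomial -/

/-- The equations between coordinates of the same colour. -/
def monochromatic {q : ℕ} (K : Finset (DiffEq n)) (m : Fin n → Fin q) : Finset (DiffEq n) :=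
  K.filter fun k => m k.1 = m k.2.1

/-- The connectedness relation of the graph formed by the index pairs of a system. -/
def linkSetoid (B : Finset (DiffEq n)) : Setoid (Fin n) :=
  Relation.EqvGen.setoid fun i j => ∃ k ∈ B, k.1 = i ∧ k.2.1 = j

theorem eq_of_linked {B : Finset (DiffEq n)} {β : Type*} {f : Fin n → β}
    (hf : ∀ k ∈ B, f k.1 = f k.2.1) {i j : Fin n} (h : (linkSetoid B).r i j) : f i = f j := by
  induction h with
  | rel i j h =>
    obtain ⟨k, hk, rfl, rfl⟩ := h
    exact hf k hk
  | refl => rfl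
  | symm _ _ _ ih => exact ih.symm
  | trans _ _ _ _ _ ih1 ih2 => exact ih1.trans ih2

theorem linked_of_mem {B : Finset (DiffEq n)} {k : DiffEq n} (hk : k ∈ B) :
    (linkSetoid B).r k.1 k.2.1 := Relation.EqvGen.rel _ _ ⟨k, hk, rfl, rfl⟩

/-- Functions that satisfy `f i = f j` for all index pairs of a system are functions on the
connected components. -/
def linkEquiv (B : Finset (DiffEq n)) (β : Type*) :
    {f : Fin n → β // ∀ k ∈ B, f k.1 = f k.2.1} ≃ (Quotient (linkSetoid B) → β) where
  toFun f := Quotient.lift f.1 fun _ _ h => eq_of_linked f.2 h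
  invFun g := ⟨fun i => g (Quotient.mk _ i), fun _ hk =>
    congrArg g (Quotient.sound (s := linkSetoid B) (linked_of_mem hk))⟩
  left_inv _ := rfl
  right_inv g := by
    funext x
    induction x using Quotient.inductionOn
    rfl

theorem card_quotient_linkSetoid (B : Finset (DiffEq n)) :
    Fintype.card (Quotient (linkSetoid B)) = n - rk B := by
  let φ : (Quotient (linkSetoid B) → ℝ) →ₗ[ℝ] E n :=
    (WithLp.linearEquiv 2 ℝ (Fin n → ℝ)).symm.toLinearMap ∘ₗ
      LinearMap.funLeft ℝ ℝ (Quotient.mk (linkSetoid B))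
  have hφ : Function.Injective φ :=
    (WithLp.linearEquiv 2 ℝ (Fin n → ℝ)).symm.injective.comp
      (LinearMap.funLeft_injective_of_surjective _ _ _ Quotient.mk_surjective)
  have hr : LinearMap.range φ = (edgeSpan B)ᗮ := by
    ext v
    rw [mem_edgeSpan_orthogonal, LinearMap.mem_range]
    constructor
    · rintro ⟨g, rfl⟩
      exact ((linkEquiv B ℝ).symm g).2
    · intro hv
      exact ⟨linkEquiv B ℝ ⟨v, hv⟩, rfl⟩
  rw [← finrank_orthogonal_edgeSpan, ← hr, LinearMap.finrank_range_of_inj hφ,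
    Module.finrank_fintype_fun_eq_card]

/-- The number of colourings that are constant along the equations in `B`. -/
theorem card_colourings (B : Finset (DiffEq n)) (q : ℕ) :
    (Finset.univ.filter fun m : Fin n → Fin q => ∀ k ∈ B, m k.1 = m k.2.1).card =
      q ^ (n - rk B) := by
  rw [← Fintype.card_subtype, Fintype.card_congr (linkEquiv B (Fin q)), Fintype.card_fun,
    Fintype.card_fin, card_quotient_linkSetoid]

/-- The affine hull of a cell of the monochromatic equations lies in a flat of `K` only if the
equations of this flat are monochromatic: one may translate the coordinates of one colour. -/
theorem subset_monochromatic {q : ℕ} {B K : Finset (DiffEq n)} (hBK : B ⊆ K) {m : Fin n → Fin q}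
    {σ : DiffEq n → SignType} (hσ : σ ∈ covectors (monochromatic K m))
    (h : solSpace (zeros (monochromatic K m) σ) ≤ solSpace B) : B ⊆ monochromatic K m := by
  intro k hk
  refine Finset.mem_filter.2 ⟨hBK hk, ?_⟩
  by_contra hne
  obtain ⟨p, rfl⟩ := mem_covectors.1 hσ
  let v : E n := WithLp.toLp 2 fun i => if m i = m k.1 then (1 : ℝ) else 0
  have hv : ∀ i, v i = if m i = m k.1 then (1 : ℝ) else 0 := fun _ => rfl
  have h1 := mem_solSpace.1 (h (mem_solSpace_zeros_signs _ p)) k hk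
  have h2 : p + v ∈ solSpace (zeros (monochromatic K m) (signs (monochromatic K m) p)) := by
    refine mem_solSpace.2 fun l hl => ?_
    have hl' := mem_zeros_signs.1 hl
    rw [defect_add, hl'.2, hv, hv, (Finset.mem_filter.1 hl'.1).2, sub_self, add_zero]
  have h3 := mem_solSpace.1 (h h2) k hk
  rw [defect_add, h1, hv, hv, if_pos rfl, if_neg (Ne.symm hne)] at h3
  norm_num at h3

theorem monochromatic_subset {q : ℕ} (K : Finset (DiffEq n)) (m : Fin n → Fin q) :
    monochromatic K m ⊆ K := Finset.filter_subset _ _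

theorem sum_cellSum_monochromatic {K B : Finset (DiffEq n)} {q : ℕ} (m : Fin n → Fin q)
    (hB : B ⊆ K) (hp : ∃ p, p ∈ solSpace B) :
    ∑ Y ∈ flats (arr K) with Y ≤ solSpace B, cellSum (monochromatic K m) Y =
      if ∀ k ∈ B, m k.1 = m k.2.1 then (-1) ^ rk B else 0 := by
  split_ifs with hm
  · exact sum_cellSum (fun k hk => Finset.mem_filter.2 ⟨hB hk, hm k hk⟩)
      (monochromatic_subset K m) hp
  · refine Finset.sum_eq_zero fun Y hY => Finset.sum_eq_zero fun σ hσ => ?_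
    obtain ⟨hσ', rfl⟩ := Finset.mem_filter.1 hσ
    refine absurd (fun k hk => ?_) hm
    exact (Finset.mem_filter.1 (subset_monochromatic hB hσ' (Finset.mem_filter.1 hY).2 hk)).2

/-- The signed number, over all colourings with `q` colours, of the monochromatic cells with affine
hull `Y`. Its sums over the flats inside a given flat `X` are the powers `(-q) ^ dim X`. -/
def colourSum (K : Finset (DiffEq n)) (q : ℕ) (Y : AffineSubspace ℝ (E n)) : ℚ :=
  (-1) ^ n * ∑ m : Fin n → Fin q, cellSum (monochromatic K m) Y

theorem sum_colourSum (K : Finset (DiffEq n)) (q : ℕ) (X : IntersectionPoset (arr K)) :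
    ∑ Y with X ≤ Y, colourSum K q Y.flat = (-(q : ℚ)) ^ X.dim := by
  obtain ⟨B, hB, hp, rfl⟩ := exists_flatMk X
  have hdim : (flatMk hB hp).dim = n - rk B := finrank_direction_solSpace hp.choose_spec
  rw [sum_intersectionPoset, flat_flatMk, hdim]
  unfold colourSum
  rw [← Finset.mul_sum, Finset.sum_comm,
    Finset.sum_congr rfl fun m _ => sum_cellSum_monochromatic m hB hp, ← Finset.sum_filter,
    Finset.sum_const, card_colourings, nsmul_eq_mul, Nat.cast_pow, neg_pow (q : ℚ)]
  have h2 : (-1 : ℚ) ^ n = (-1) ^ (n - rk B) * (-1) ^ rk B := by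
    rw [← pow_add, Nat.sub_add_cancel (rk_le B)]
  have h3 : ((-1 : ℚ) ^ rk B) * (-1) ^ rk B = 1 := by rw [← mul_pow]; norm_num
  rw [h2]
  linear_combination (-1 : ℚ) ^ (n - rk B) * (q : ℚ) ^ (n - rk B) * h3

theorem eval_whitney_eq_sum {A : Arrangement n} (a b : ℚ) :
    MvPolynomial.eval ![a, b] (whitney A) =
      ∑ X : IntersectionPoset A, a ^ X.codim *
        ∑ Y with X ≤ Y, IncidenceAlgebra.mu ℚ X Y * b ^ Y.dim := by
  unfold whitney
  rw [map_sum]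
  refine Finset.sum_congr rfl fun X _ => ?_
  rw [map_sum, Finset.mul_sum]
  refine Finset.sum_congr (by congr) fun Y _ => ?_
  simp only [map_mul, map_pow, MvPolynomial.eval_C, xVar, tVar, MvPolynomial.eval_X,
    Matrix.cons_val_zero, Matrix.cons_val_one, IntersectionPoset.codim]
  ring

/-- The value of the Whitney polynomial at `t = -q` enumerates, over all colourings with `q`
colours, the cells of the monochromatic subarrangements. -/
theorem eval_whitney (K : Finset (DiffEq n)) (a : ℚ) (q : ℕ) :
    MvPolynomial.eval ![a, -(q : ℚ)] (whitney (arr K)) =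
      (-1) ^ n * ∑ m : Fin n → Fin q, phi (monochromatic K m) (-a) := by
  have h1 : ∀ X : IntersectionPoset (arr K),
      ∑ Y with X ≤ Y, IncidenceAlgebra.mu ℚ X Y * (-(q : ℚ)) ^ Y.dim = colourSum K q X.flat :=
    fun X => sum_mu_mul (fun X : IntersectionPoset (arr K) => colourSum K q X.flat) _
      (sum_colourSum K q) X
  rw [eval_whitney_eq_sum, Finset.sum_congr rfl fun X _ => congrArg (a ^ X.codim * ·) (h1 X)]
  have h2 := sum_univ_intersectionPoset (A := arr K)
    (fun Y => a ^ (n - Module.finrank ℝ Y.direction) * colourSum K q Y)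
  refine h2.trans ?_
  simp only [colourSum, mul_left_comm _ ((-1 : ℚ) ^ n)]
  rw [← Finset.mul_sum]
  simp only [Finset.mul_sum]
  rw [Finset.sum_comm]
  refine Finset.sum_congr rfl fun m _ => ?_
  rw [← Finset.mul_sum, sum_flats_mul_cellSum (monochromatic_subset K m) a, phi]

/-! ### Faces, their dimensions and their levels -/

/-- The set of points with a given sign vector. -/
def cell (K : Finset (DiffEq n)) (σ : DiffEq n → SignType) : Set (E n) := {p | signs K p = σ}

theorem mem_cell {K : Finset (DiffEq n)} {σ : DiffEq n → SignType} {p : E n} :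
    p ∈ cell K σ ↔ signs K p = σ := Iff.rfl

theorem convex_cell (K : Finset (DiffEq n)) (σ : DiffEq n → SignType) : Convex ℝ (cell K σ) := by
  refine convex_iff_segment_subset.2 fun p hp q hq => ?_
  rw [segment_eq_image']
  rintro _ ⟨t, ht, rfl⟩
  exact signs_segment hp hq ht.1 ht.2

theorem mem_arr {K : Finset (DiffEq n)} {H : AffineSubspace ℝ (E n)} :
    H ∈ arr K ↔ ∃ k ∈ K, hyp k = H := by
  simp [arr]

theorem mem_complement {A : Arrangement n} {X : AffineSubspace ℝ (E n)} {p : E n} :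
    p ∈ complement A X ↔ p ∈ X ∧ ∀ H ∈ A, ¬ X ≤ H → p ∉ H := by
  simp only [complement, Set.mem_sdiff, Set.mem_iUnion, not_exists, SetLike.mem_coe]

theorem connectedComponentIn_complement {K : Finset (DiffEq n)} {X : AffineSubspace ℝ (E n)}
    (hX : X ∈ flats (arr K)) {p : E n} (hp : p ∈ complement (arr K) X) :
    connectedComponentIn (complement (arr K) X) p = cell K (signs K p) := by
  obtain ⟨B, hB, rfl, -⟩ := mem_flats_arr.1 hX
  have hp' := mem_complement.1 hp
  apply subset_antisymm
  · intro q hq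
    have hq' := mem_complement.1 (connectedComponentIn_subset _ _ hq)
    rw [mem_cell, signs_eq_signs_iff]
    intro k hk
    by_cases hle : solSpace B ≤ hyp k
    · rw [mem_hyp.1 (hle hp'.1), mem_hyp.1 (hle hq'.1)]
    · -- The defect has no zero on the connected component, hence constant sign.
      have hne : ∀ r ∈ connectedComponentIn (complement (arr K) (solSpace B)) p,
          defect k r ≠ 0 := fun r hr h0 =>
        (mem_complement.1 (connectedComponentIn_subset _ _ hr)).2 _ (mem_arr.2 ⟨k, hk, rfl⟩) hle
          (mem_hyp.2 h0)
      have hpc := mem_connectedComponentIn hp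
      have hpre := isPreconnected_connectedComponentIn (F := complement (arr K) (solSpace B))
        (x := p)
      have hc := (continuous_defect k).continuousOn
        (s := connectedComponentIn (complement (arr K) (solSpace B)) p)
      rcases lt_or_gt_of_ne (hne p hpc) with h | h <;> rcases lt_or_gt_of_ne (hne q hq) with h' | h'
      · rw [sign_neg h, sign_neg h']
      · obtain ⟨r, hr, h0⟩ := hpre.intermediate_value hpc hq hc ⟨h.le, h'.le⟩
        exact absurd h0 (hne r hr)
      · obtain ⟨r, hr, h0⟩ := hpre.intermediate_value hq hpc hc ⟨h'.le, h.le⟩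
        exact absurd h0 (hne r hr)
      · rw [sign_pos h, sign_pos h']
  · refine (convex_cell K _).isPreconnected.subset_connectedComponentIn (mem_cell.2 rfl) ?_
    intro q hq
    rw [mem_cell, signs_eq_signs_iff] at hq
    refine mem_complement.2 ⟨mem_solSpace.2 fun k hk => ?_, ?_⟩
    · have := hq k (hB hk)
      rwa [mem_solSpace.1 hp'.1 k hk, sign_zero, sign_eq_zero_iff] at this
    · intro H hH hle hqH
      obtain ⟨k, hk, rfl⟩ := mem_arr.1 hH
      have := hq k hk
      rw [mem_hyp.1 hqH, sign_zero, eq_comm, sign_eq_zero_iff] at this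
      exact hp'.2 _ hH hle (mem_hyp.2 this)

/-- The faces of an arrangement are the cells of its realizable sign vectors. -/
theorem faces_arr (K : Finset (DiffEq n)) : faces (arr K) = cell K '' covectors K := by
  ext F
  constructor
  · rintro ⟨X, hX, p, hp, rfl⟩
    exact ⟨signs K p, by simp, (connectedComponentIn_complement hX hp).symm⟩
  · rintro ⟨σ, hσ, rfl⟩
    obtain ⟨p, rfl⟩ := mem_covectors.1 hσ
    have hX := solSpace_zeros_mem_flats subset_rfl (mem_covectors.2 ⟨p, rfl⟩ : _ ∈ covectors K)
    have hp : p ∈ complement (arr K) (solSpace (zeros K (signs K p))) := by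
      refine mem_complement.2 ⟨mem_solSpace_zeros_signs K p, ?_⟩
      intro H hH hle hpH
      obtain ⟨k, hk, rfl⟩ := mem_arr.1 hH
      exact hle fun q hq =>
        mem_hyp.2 (mem_solSpace.1 hq k (mem_zeros_signs.2 ⟨hk, mem_hyp.1 hpH⟩))
    exact ⟨_, hX, p, hp, (connectedComponentIn_complement hX hp).symm⟩

theorem injOn_cell (K : Finset (DiffEq n)) : Set.InjOn (cell K) (covectors K) := by
  intro σ hσ τ _ h
  obtain ⟨p, rfl⟩ := mem_covectors.1 hσ
  exact (h ▸ mem_cell.2 rfl : p ∈ cell K τ)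

theorem vectorSpan_cell (K : Finset (DiffEq n)) (p : E n) :
    vectorSpan ℝ (cell K (signs K p)) = (edgeSpan (zeros K (signs K p)))ᗮ := by
  apply le_antisymm
  · refine Submodule.span_le.2 ?_
    rintro _ ⟨q, hq, r, hr, rfl⟩
    rw [mem_cell] at hq hr
    have := sub_mem_orthogonal_of_signs_eq (hq.trans hr.symm)
    rwa [hr] at this
  · intro v hv
    obtain ⟨t, ht, h, -⟩ := exists_pos_signs_add_smul hv
    have h1 := vsub_mem_vectorSpan ℝ (mem_cell.2 h) (mem_cell.2 rfl : p ∈ cell K (signs K p))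
    rw [vsub_eq_sub, add_sub_cancel_left] at h1
    simpa [smul_smul, inv_mul_cancel₀ ht.ne'] using Submodule.smul_mem _ t⁻¹ h1

theorem faceDim_cell {K : Finset (DiffEq n)} {σ : DiffEq n → SignType} (hσ : σ ∈ covectors K) :
    faceDim (cell K σ) = n - rk (zeros K σ) := by
  obtain ⟨p, rfl⟩ := mem_covectors.1 hσ
  rw [faceDim, direction_affineSpan, vectorSpan_cell, finrank_orthogonal_edgeSpan]

/-- A subspace at bounded distance from a set contains the directions of all rays in this set. -/
theorem mem_of_ray {F : Set (E n)} {W : Submodule ℝ (E n)} {r : ℝ}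
    (hr : ∀ v ∈ F, Metric.infDist v (W : Set (E n)) ≤ r) {p v : E n}
    (h : ∀ t : ℝ, 0 < t → p + t • v ∈ F) : v ∈ W := by
  have hne : (W : Set (E n)).Nonempty := ⟨0, W.zero_mem⟩
  have hle : ∀ t : ℝ, 0 < t → Metric.infDist v (W : Set (E n)) ≤ (r + 1 + ‖p‖) / t := by
    intro t ht
    obtain ⟨w, hw, hd⟩ := (Metric.infDist_lt_iff hne).1
      (lt_of_le_of_lt (hr _ (h t ht)) (lt_add_one r))
    refine (Metric.infDist_le_dist_of_mem (W.smul_mem t⁻¹ hw)).trans ?_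
    rw [le_div_iff₀ ht, dist_eq_norm]
    have h1 : ‖v - t⁻¹ • w‖ * t = ‖t • v - w‖ := by
      rw [mul_comm, ← abs_of_pos ht, ← Real.norm_eq_abs, ← norm_smul, smul_sub, smul_smul,
        Real.norm_eq_abs, abs_of_pos ht, mul_inv_cancel₀ ht.ne', one_smul]
    have h2 : t • v - w = (p + t • v - w) - p := by abel
    rw [dist_eq_norm] at hd
    rw [h1, h2]
    exact (norm_sub_le _ _).trans (by linarith)
  have h0 : Metric.infDist v (W : Set (E n)) = 0 := by
    refine le_antisymm (le_of_forall_pos_le_add fun ε hε => ?_) Metric.infDist_nonneg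
    have hpos : 0 < r + 1 + ‖p‖ := by
      have := (Metric.infDist_nonneg).trans (hr _ (h 1 one_pos))
      positivity
    refine (hle _ (div_pos hpos hε)).trans ?_
    rw [zero_add, div_div_cancel₀ hpos.ne']
  have hcl : IsClosed (W : Set (E n)) := W.closed_of_finiteDimensional
  exact (hcl.mem_iff_infDist_zero hne).2 h0

theorem level_le_of_bounded {F : Set (E n)} (W : Submodule ℝ (E n)) {r : ℝ}
    (h : ∀ v ∈ F, Metric.infDist v (W : Set (E n)) ≤ r) :
    level F ≤ Module.finrank ℝ W :=
  Nat.sInf_le ⟨W, rfl, max r 1, by positivity, fun v hv => (h v hv).trans (le_max_left _ _)⟩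

theorem exists_subspace_of_level {K : Finset (DiffEq n)} {σ : DiffEq n → SignType}
    (hσ : σ ∈ covectors K) :
    (∃ W : Submodule ℝ (E n), Module.finrank ℝ W = level (cell K σ) ∧
      ∃ r : ℝ, ∀ v ∈ cell K σ, Metric.infDist v (W : Set (E n)) ≤ r) ∧
      level (cell K σ) ≤ faceDim (cell K σ) := by
  obtain ⟨p, rfl⟩ := mem_covectors.1 hσ
  have hb : ∀ q ∈ cell K (signs K p),
      Metric.infDist q ((edgeSpan (zeros K (signs K p)))ᗮ : Set (E n)) ≤ ‖p‖ := by
    intro q hq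
    refine (Metric.infDist_le_dist_of_mem (sub_mem_orthogonal_of_signs_eq hq)).trans ?_
    rw [dist_eq_norm, sub_sub_cancel]
  have hmem : level (cell K (signs K p)) ∈ _ := Nat.sInf_mem
    ⟨_, _, rfl, ‖p‖ + 1, by positivity, fun q hq => (hb q hq).trans (by linarith)⟩
  obtain ⟨W, hW, r, -, hr⟩ := hmem
  refine ⟨⟨W, hW, r, hr⟩, (level_le_of_bounded _ hb).trans_eq ?_⟩
  rw [faceDim_cell hσ, finrank_orthogonal_edgeSpan]

theorem level_le_faceDim {K : Finset (DiffEq n)} {σ : DiffEq n → SignType}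
    (hσ : σ ∈ covectors K) : level (cell K σ) ≤ faceDim (cell K σ) :=
  (exists_subspace_of_level hσ).2

/-- The indicator vector of a set of coordinates. -/
def indicatorVec (U : Finset (Fin n)) : E n := WithLp.toLp 2 fun i => if i ∈ U then (1 : ℝ) else 0

@[simp] theorem indicatorVec_apply (U : Finset (Fin n)) (i : Fin n) :
    indicatorVec U i = if i ∈ U then (1 : ℝ) else 0 := rfl

theorem signs_add_smul_indicatorVec_univ (K : Finset (DiffEq n)) (p : E n) (t : ℝ) :
    signs K (p + t • indicatorVec Finset.univ) = signs K p := by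
  rw [signs_eq_signs_iff]
  intro k _
  rw [defect_add_smul]
  simp

theorem one_le_level [NeZero n] {K : Finset (DiffEq n)} {σ : DiffEq n → SignType}
    (hσ : σ ∈ covectors K) : 1 ≤ level (cell K σ) := by
  obtain ⟨⟨W, hW, r, hr⟩, -⟩ := exists_subspace_of_level hσ
  obtain ⟨p, rfl⟩ := mem_covectors.1 hσ
  have h1 := mem_of_ray hr (p := p) (v := indicatorVec Finset.univ)
    fun t _ => mem_cell.2 (signs_add_smul_indicatorVec_univ K p t)
  rw [← hW, Nat.one_le_iff_ne_zero]
  intro h0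
  rw [Submodule.finrank_eq_zero] at h0
  rw [h0, Submodule.mem_bot] at h1
  have := congrArg (fun v : E n => v 0) h1
  simp at this

/-- The relation forcing `v_i ≥ v_j` for all vectors `v` of the recession cone of the cell of `σ`:
some equation between `x_i` and `x_j` bounds `x_i - x_j` from below on the cell. -/
def Beats (K : Finset (DiffEq n)) (σ : DiffEq n → SignType) (i j : Fin n) : Prop :=
  (∃ c, (i, j, c) ∈ K ∧ 0 ≤ σ (i, j, c)) ∨ ∃ c, (j, i, c) ∈ K ∧ σ (j, i, c) ≤ 0

/-- No index outside `T` beats an index of `T`. Equivalently, the indicator vector of `T` belongs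
to the recession cone of the cell of `σ`. -/
def Dominant (K : Finset (DiffEq n)) (σ : DiffEq n → SignType) (T : Finset (Fin n)) : Prop :=
  ∀ i ∈ T, ∀ j ∉ T, ¬ Beats K σ j i

/-- `T` is nonempty, with no proper nonempty dominant subset. -/
def Indecomposable (K : Finset (DiffEq n)) (σ : DiffEq n → SignType) (T : Finset (Fin n)) :
    Prop :=
  T.Nonempty ∧ ∀ U ⊆ T, U.Nonempty → Dominant K σ U → U = T

theorem signs_add_smul_indicatorVec {K : Finset (DiffEq n)} {p : E n} {U : Finset (Fin n)}
    (hU : Dominant K (signs K p) U) {t : ℝ} (ht : 0 < t) :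
    signs K (p + t • indicatorVec U) = signs K p := by
  rw [signs_eq_signs_iff]
  rintro ⟨i, j, c⟩ hk
  rw [defect_add_smul, indicatorVec_apply, indicatorVec_apply]
  by_cases hi : i ∈ U <;> by_cases hj : j ∈ U
  · simp [hi, hj]
  · have h1 : 0 < defect (i, j, c) p := by
      by_contra h
      exact hU i hi j hj (Or.inr ⟨c, hk, by
        rw [signs_of_mem hk, sign_nonpos_iff]; exact not_lt.1 h⟩)
    rw [sign_pos h1, sign_pos]
    simp only [hi, hj, if_true, if_false]
    linarith
  · have h1 : defect (i, j, c) p < 0 := by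
      by_contra h
      exact hU j hj i hi (Or.inl ⟨c, hk, by
        rw [signs_of_mem hk, sign_nonneg_iff]; exact not_lt.1 h⟩)
    rw [sign_neg h1, sign_neg]
    simp only [hi, hj, if_true, if_false]
    linarith
  · simp [hi, hj]

theorem Beats.exists_le {K : Finset (DiffEq n)} {σ : DiffEq n → SignType} {i j : Fin n}
    (h : Beats K σ i j) : ∃ c : ℝ, ∀ q ∈ cell K σ, c ≤ q i - q j := by
  rcases h with ⟨c, hk, h⟩ | ⟨c, hk, h⟩
  · refine ⟨c, fun q hq => ?_⟩
    rw [← mem_cell.1 hq, signs_of_mem hk, sign_nonneg_iff, defect] at h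
    linarith
  · refine ⟨-c, fun q hq => ?_⟩
    rw [← mem_cell.1 hq, signs_of_mem hk, sign_nonpos_iff, defect] at h
    linarith

/-- On the cell of an indecomposable sign vector all coordinate differences are bounded: the indices
`j` for which `x_i - x_j` is not bounded below would form a proper dominant set. -/
theorem exists_le_of_indecomposable {K : Finset (DiffEq n)} {σ : DiffEq n → SignType}
    (h : Indecomposable K σ Finset.univ) (i j : Fin n) :
    ∃ c : ℝ, ∀ q ∈ cell K σ, c ≤ q i - q j := by
  let V : Finset (Fin n) :=
    Finset.univ.filter fun j => ¬ ∃ c : ℝ, ∀ q ∈ cell K σ, c ≤ q i - q j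
  have hV : ∀ j, j ∈ V ↔ ¬ ∃ c : ℝ, ∀ q ∈ cell K σ, c ≤ q i - q j := fun j => by simp [V]
  by_contra hj
  have hiV : i ∉ V := by
    rw [hV, not_not]
    exact ⟨0, fun q _ => by simp⟩
  have hnd : ¬ Dominant K σ V := fun hd =>
    hiV (h.2 V (Finset.subset_univ _) ⟨j, (hV j).2 hj⟩ hd ▸ Finset.mem_univ i)
  simp only [Dominant, not_forall, not_not] at hnd
  obtain ⟨v, hv, u, hu, hb⟩ := hnd
  obtain ⟨c, hc⟩ := hb.exists_le
  rw [hV, not_not] at hu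
  obtain ⟨d, hd⟩ := hu
  exact (hV v).1 hv ⟨c + d, fun q hq => by linarith [hc q hq, hd q hq]⟩

/-- A face has level one exactly when all its coordinate differences are bounded. -/
theorem level_eq_one_iff [NeZero n] {K : Finset (DiffEq n)} {σ : DiffEq n → SignType}
    (hσ : σ ∈ covectors K) : level (cell K σ) = 1 ↔ Indecomposable K σ Finset.univ := by
  constructor
  · intro h
    obtain ⟨⟨W, hW, r, hr⟩, -⟩ := exists_subspace_of_level hσ
    obtain ⟨p, rfl⟩ := mem_covectors.1 hσ
    refine ⟨Finset.univ_nonempty, fun U _ hne hd => ?_⟩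
    by_contra hU
    -- The line `W` would contain two independent vectors, the indicators of `U` and of all indices.
    have h1 := mem_of_ray hr (p := p) (v := indicatorVec Finset.univ)
      fun t _ => mem_cell.2 (signs_add_smul_indicatorVec_univ K p t)
    have h2 := mem_of_ray hr (p := p) (v := indicatorVec U)
      fun t ht => mem_cell.2 (signs_add_smul_indicatorVec hd ht)
    obtain ⟨i, hi⟩ := hne
    obtain ⟨j, hj⟩ : ∃ j, j ∉ U := by
      by_contra hall
      push Not at hall
      exact hU (Finset.eq_univ_iff_forall.2 hall)
    rw [h, finrank_eq_one_iff'] at hW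
    obtain ⟨v, -, hv⟩ := hW
    obtain ⟨a, ha⟩ := hv ⟨_, h1⟩
    obtain ⟨b, hb⟩ := hv ⟨_, h2⟩
    have a1 : a * (v : E n) i = 1 := by
      simpa using congrArg (fun w : W => (w : E n) i) ha
    have a2 : a * (v : E n) j = 1 := by
      simpa using congrArg (fun w : W => (w : E n) j) ha
    have b1 : b * (v : E n) i = 1 := by
      simpa [hi] using congrArg (fun w : W => (w : E n) i) hb
    have b2 : b * (v : E n) j = 0 := by
      simpa [hj] using congrArg (fun w : W => (w : E n) j) hb
    have : (0 : ℝ) = 1 := by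
      linear_combination b1 * (a * (v : E n) j) - b2 * (a * (v : E n) i) + a2
    norm_num at this
  · intro h
    refine le_antisymm ?_ (one_le_level hσ)
    choose c hc using exists_le_of_indecomposable h
    have hb : ∀ q ∈ cell K σ, Metric.infDist q
        (Submodule.span ℝ {indicatorVec (Finset.univ : Finset (Fin n))} : Set (E n)) ≤
          √(∑ i, (|c i 0| + |c 0 i|) ^ 2) := by
      intro q hq
      refine (Metric.infDist_le_dist_of_mem
        (Submodule.smul_mem _ (q 0) (Submodule.mem_span_singleton_self _))).trans ?_
      rw [EuclideanSpace.dist_eq]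
      refine Real.sqrt_le_sqrt (Finset.sum_le_sum fun i _ => ?_)
      refine pow_le_pow_left₀ dist_nonneg ?_ 2
      have h1 := hc i 0 q hq
      have h2 := hc 0 i q hq
      simp only [PiLp.smul_apply, indicatorVec_apply, Finset.mem_univ, if_true, smul_eq_mul,
        mul_one, Real.dist_eq]
      rw [abs_le]
      constructor
      · linarith [neg_abs_le (c i 0), abs_nonneg (c 0 i)]
      · linarith [neg_abs_le (c 0 i), abs_nonneg (c i 0)]
    refine (level_le_of_bounded _ hb).trans (le_of_eq ?_)
    refine finrank_span_singleton fun h0 => ?_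
    have := congrArg (fun v : E n => v 0) h0
    simp at this

/-! ### Splitting cells along sets of coordinates -/

/-- The equations between coordinates in `S`. -/
def within (K : Finset (DiffEq n)) (S : Finset (Fin n)) : Finset (DiffEq n) :=
  K.filter fun k => k.1 ∈ S ∧ k.2.1 ∈ S

@[simp] theorem mem_within {K : Finset (DiffEq n)} {S : Finset (Fin n)} {k : DiffEq n} :
    k ∈ within K S ↔ k ∈ K ∧ k.1 ∈ S ∧ k.2.1 ∈ S := by
  simp [within]

theorem within_subset (K : Finset (DiffEq n)) (S : Finset (Fin n)) : within K S ⊆ K :=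
  Finset.filter_subset _ _

theorem within_within (K : Finset (DiffEq n)) (S T : Finset (Fin n)) :
    within (within K S) T = within K (S ∩ T) := by
  ext k
  simp only [mem_within, Finset.mem_inter]
  tauto

theorem Dominant.eq_one {K : Finset (DiffEq n)} {σ : DiffEq n → SignType} {T : Finset (Fin n)}
    (h : Dominant K σ T) {k : DiffEq n} (hk : k ∈ K) (h1 : k.1 ∈ T) (h2 : k.2.1 ∉ T) :
    σ k = 1 := by
  have hlt : 0 < σ k := not_le.1 fun hle => h _ h1 _ h2 (Or.inr ⟨k.2.2, hk, hle⟩)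
  revert hlt
  generalize σ k = s
  revert s
  decide

theorem Dominant.eq_neg_one {K : Finset (DiffEq n)} {σ : DiffEq n → SignType}
    {T : Finset (Fin n)} (h : Dominant K σ T) {k : DiffEq n} (hk : k ∈ K) (h1 : k.1 ∉ T)
    (h2 : k.2.1 ∈ T) : σ k = -1 := by
  have hlt : σ k < 0 := not_le.1 fun hle => h _ h2 _ h1 (Or.inl ⟨k.2.2, hk, hle⟩)
  revert hlt
  generalize σ k = s
  revert s
  decide

/-- Moving the coordinates in `T` far up makes `T` dominant, with prescribed positions of the
coordinates inside and outside `T`. -/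
theorem exists_dominant (K : Finset (DiffEq n)) (T : Finset (Fin n)) (p q : E n) :
    ∃ r : E n, Dominant K (signs K r) T ∧ signs (within K T) r = signs (within K T) p ∧
      signs (within K Tᶜ) r = signs (within K Tᶜ) q := by
  obtain ⟨M, hM⟩ := ((Filter.eventually_all_finset K).2 fun k _ =>
    (Filter.eventually_gt_atTop (-(p k.1 - q k.2.1 - k.2.2))).and
      (Filter.eventually_gt_atTop (q k.1 - p k.2.1 - k.2.2))).exists
  let r : E n := WithLp.toLp 2 fun i => if i ∈ T then p i + M else q i
  have hr : ∀ i, r i = if i ∈ T then p i + M else q i := fun _ => rfl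
  refine ⟨r, ?_, ?_, ?_⟩
  · rintro i hi j hj (⟨c, hk, h⟩ | ⟨c, hk, h⟩)
    · rw [signs_of_mem hk, sign_nonneg_iff, defect] at h
      simp only [hr, if_pos hi, if_neg hj] at h
      have := (hM _ hk).2
      simp only at this
      linarith
    · rw [signs_of_mem hk, sign_nonpos_iff, defect] at h
      simp only [hr, if_pos hi, if_neg hj] at h
      have := (hM _ hk).1
      simp only at this
      linarith
  · rw [signs_eq_signs_iff]
    intro k hk
    obtain ⟨-, h1, h2⟩ := mem_within.1 hk
    rw [defect, defect, hr, hr, if_pos h1, if_pos h2, add_sub_add_right_eq_sub]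
  · rw [signs_eq_signs_iff]
    intro k hk
    obtain ⟨-, h1, h2⟩ := mem_within.1 hk
    rw [Finset.mem_compl] at h1 h2
    rw [defect, defect, hr, hr, if_neg h1, if_neg h2]

theorem Dominant.zeros_eq {K : Finset (DiffEq n)} {σ : DiffEq n → SignType} {T : Finset (Fin n)}
    (h : Dominant K σ T) : zeros K σ = zeros (within K T) (restrict (within K T) σ) ∪
      zeros (within K Tᶜ) (restrict (within K Tᶜ) σ) := by
  ext k
  rw [Finset.mem_union]
  simp only [mem_zeros, restrict]
  by_cases hk : k ∈ K
  · by_cases h1 : k.1 ∈ T <;> by_cases h2 : k.2.1 ∈ T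
    · simp [hk, h1, h2]
    · simp [hk, h1, h2, h.eq_one hk h1 h2]
    · simp [hk, h1, h2, h.eq_neg_one hk h1 h2]
    · simp [hk, h1, h2]
  · simp [hk]

theorem Dominant.rk_zeros {K : Finset (DiffEq n)} {σ : DiffEq n → SignType}
    {T : Finset (Fin n)} (h : Dominant K σ T) :
    rk (zeros K σ) = rk (zeros (within K T) (restrict (within K T) σ)) +
      rk (zeros (within K Tᶜ) (restrict (within K Tᶜ) σ)) := by
  rw [h.zeros_eq, rk_union T]
  · exact fun k hk => (mem_within.1 (mem_zeros.1 hk).1).2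
  · intro k hk
    simpa using (mem_within.1 (mem_zeros.1 hk).1).2

/-- The cells for which `T` is dominant are products of cells in the coordinates inside and
outside `T`. -/
theorem sum_dominant (K : Finset (DiffEq n)) (T : Finset (Fin n))
    (P : (DiffEq n → SignType) → Prop) (z : ℚ) :
    ∑ σ ∈ covectors K with Dominant K σ T ∧ P (restrict (within K T) σ), z ^ rk (zeros K σ) =
      (∑ σ ∈ covectors (within K T) with P σ, z ^ rk (zeros (within K T) σ)) *
        phi (within K Tᶜ) z := by
  rw [phi, Finset.sum_mul_sum, ← Finset.sum_product']
  refine Finset.sum_nbij (fun σ => (restrict (within K T) σ, restrict (within K Tᶜ) σ))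
    ?_ ?_ ?_ ?_
  · intro σ hσ
    obtain ⟨h1, -, h3⟩ := Finset.mem_filter.1 hσ
    obtain ⟨p, rfl⟩ := mem_covectors.1 h1
    rw [Finset.mem_product, Finset.mem_filter]
    exact ⟨⟨mem_covectors.2 ⟨p, (restrict_signs (within_subset _ _) p).symm⟩, h3⟩,
      mem_covectors.2 ⟨p, (restrict_signs (within_subset _ _) p).symm⟩⟩
  · intro σ hσ τ hτ h
    obtain ⟨h1, hd, -⟩ := Finset.mem_filter.1 (Finset.mem_coe.1 hσ)
    obtain ⟨h1', hd', -⟩ := Finset.mem_filter.1 (Finset.mem_coe.1 hτ)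
    obtain ⟨p, rfl⟩ := mem_covectors.1 h1
    obtain ⟨q, rfl⟩ := mem_covectors.1 h1'
    obtain ⟨ha, hb⟩ := Prod.ext_iff.1 h
    funext k
    by_cases hk : k ∈ K
    · by_cases h1 : k.1 ∈ T <;> by_cases h2 : k.2.1 ∈ T
      · have hk' : k ∈ within K T := mem_within.2 ⟨hk, h1, h2⟩
        simpa only [restrict_of_mem hk'] using congrFun ha k
      · rw [hd.eq_one hk h1 h2, hd'.eq_one hk h1 h2]
      · rw [hd.eq_neg_one hk h1 h2, hd'.eq_neg_one hk h1 h2]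
      · have hk' : k ∈ within K Tᶜ := by simp [hk, h1, h2]
        simpa only [restrict_of_mem hk'] using congrFun hb k
    · rw [signs_of_notMem hk, signs_of_notMem hk]
  · rintro ⟨σ, τ⟩ hστ
    obtain ⟨hσ, hτ⟩ := Finset.mem_product.1 (Finset.mem_coe.1 hστ)
    obtain ⟨h1, hP⟩ := Finset.mem_filter.1 hσ
    obtain ⟨p, hp⟩ := mem_covectors.1 h1
    obtain ⟨q, hq⟩ := mem_covectors.1 hτ
    obtain ⟨r, hd, hr1, hr2⟩ := exists_dominant K T p q
    have e1 : restrict (within K T) (signs K r) = σ := by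
      rw [restrict_signs (within_subset _ _), hr1]; exact hp
    have e2 : restrict (within K Tᶜ) (signs K r) = τ := by
      rw [restrict_signs (within_subset _ _), hr2]; exact hq
    refine ⟨signs K r, ?_, Prod.ext e1 e2⟩
    rw [Finset.mem_coe, Finset.mem_filter, e1]
    exact ⟨mem_covectors.2 ⟨r, rfl⟩, hd, hP⟩
  · intro σ hσ
    rw [(Finset.mem_filter.1 hσ).2.1.rk_zeros, pow_add]

/-- Without equations across `T`, the generating polynomial of the cells is a product. -/
theorem phi_eq_mul {K : Finset (DiffEq n)} {T : Finset (Fin n)}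
    (h : ∀ k ∈ K, k.1 ∈ T ↔ k.2.1 ∈ T) (z : ℚ) :
    phi K z = phi (within K T) z * phi (within K Tᶜ) z := by
  have hd : ∀ σ, Dominant K σ T := by
    rintro σ i hi j hj (⟨c, hk, -⟩ | ⟨c, hk, -⟩)
    · exact hj ((h _ hk).2 hi)
    · exact hj ((h _ hk).1 hi)
  have := sum_dominant K T (fun _ => True) z
  simp only [hd, and_self, Finset.filter_true] at this
  exact this

@[simp] theorem phi_empty (z : ℚ) : phi (∅ : Finset (DiffEq n)) z = 1 := by
  have : covectors (∅ : Finset (DiffEq n)) = {signs ∅ 0} := by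
    ext σ
    rw [mem_covectors, Finset.mem_singleton]
    constructor
    · rintro ⟨p, rfl⟩
      exact signs_eq_signs_iff.2 (by simp)
    · rintro rfl
      exact ⟨0, rfl⟩
  rw [phi, this, Finset.sum_singleton]
  simp [zeros]

theorem phi_monochromatic {q : ℕ} (K : Finset (DiffEq n)) (m : Fin n → Fin q) (z : ℚ) :
    phi (monochromatic K m) z =
      ∏ c, phi (within K (Finset.univ.filter fun i => m i = c)) z := by
  have key : ∀ I : Finset (Fin q), phi (K.filter fun k => m k.1 = m k.2.1 ∧ m k.1 ∈ I) z =
      ∏ c ∈ I, phi (within K (Finset.univ.filter fun i => m i = c)) z := by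
    intro I
    induction I using Finset.induction_on with
    | empty => simp
    | insert c I hc ih =>
      rw [Finset.prod_insert hc, ← ih,
        phi_eq_mul (T := Finset.univ.filter fun i => m i = c)]
      · congr 2
        · ext ⟨i, j, a⟩
          simp only [mem_within, Finset.mem_filter, Finset.mem_univ, true_and,
            Finset.mem_insert]
          constructor
          · exact fun h => ⟨h.1.1, h.2⟩
          · exact fun h => ⟨⟨h.1, h.2.1.trans h.2.2.symm, Or.inl h.2.1⟩, h.2⟩
        · ext ⟨i, j, a⟩
          simp only [mem_within, Finset.mem_filter, Finset.mem_univ, true_and,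
            Finset.mem_insert, Finset.mem_compl]
          constructor
          · exact fun h => ⟨h.1.1, h.1.2.1, h.1.2.2.resolve_left h.2.1⟩
          · refine fun h => ⟨⟨h.1, h.2.1, Or.inr h.2.2⟩, ?_, ?_⟩
            · rintro rfl; exact hc h.2.2
            · intro h'; exact hc (h' ▸ h.2.1 ▸ h.2.2)
      · intro k hk
        have := (Finset.mem_filter.1 hk).2.1
        simp [this]
  rw [← key Finset.univ, monochromatic]
  simp

/-- The generating polynomial, by codimension, of the cells in the coordinates in `T` that have
bounded coordinate differences. -/
def boundedPhi (K : Finset (DiffEq n)) (T : Finset (Fin n)) (z : ℚ) : ℚ :=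
  ∑ σ ∈ covectors (within K T) with Indecomposable (within K T) σ T,
    z ^ rk (zeros (within K T) σ)

theorem beats_within_iff {K : Finset (DiffEq n)} {σ : DiffEq n → SignType} {T : Finset (Fin n)}
    {i j : Fin n} : Beats (within K T) (restrict (within K T) σ) i j ↔
      i ∈ T ∧ j ∈ T ∧ Beats K σ i j := by
  constructor
  · rintro (⟨c, hk, h⟩ | ⟨c, hk, h⟩)
    · rw [restrict_of_mem hk] at h
      obtain ⟨h0, h1, h2⟩ := mem_within.1 hk
      exact ⟨h1, h2, Or.inl ⟨c, h0, h⟩⟩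
    · rw [restrict_of_mem hk] at h
      obtain ⟨h0, h1, h2⟩ := mem_within.1 hk
      exact ⟨h2, h1, Or.inr ⟨c, h0, h⟩⟩
  · rintro ⟨hi, hj, ⟨c, hk, h⟩ | ⟨c, hk, h⟩⟩
    · have hk' : (i, j, c) ∈ within K T := mem_within.2 ⟨hk, hi, hj⟩
      exact Or.inl ⟨c, hk', by rwa [restrict_of_mem hk']⟩
    · have hk' : (j, i, c) ∈ within K T := mem_within.2 ⟨hk, hj, hi⟩
      exact Or.inr ⟨c, hk', by rwa [restrict_of_mem hk']⟩

/-- If all pairs of coordinates in `S` occur in equations, then every cell has exactly one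
dominant subset of `S` that is indecomposable: the dominant sets form a chain, and this is its
least member. -/
theorem existsUnique_dominant {K : Finset (DiffEq n)} {S : Finset (Fin n)} (hS : S.Nonempty)
    (hK : ∀ k ∈ K, k.1 ∈ S ∧ k.2.1 ∈ S)
    (htot : ∀ i ∈ S, ∀ j ∈ S, i ≠ j → ∃ c, (i, j, c) ∈ K ∨ (j, i, c) ∈ K)
    (σ : DiffEq n → SignType) :
    ∃! T, T ⊆ S ∧ Dominant K σ T ∧
      Indecomposable (within K T) (restrict (within K T) σ) T := by
  have hbeats : ∀ i ∈ S, ∀ j ∈ S, i ≠ j → Beats K σ i j ∨ Beats K σ j i := by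
    intro i hi j hj hij
    obtain ⟨c, hc | hc⟩ := htot i hi j hj hij
    · rcases le_total 0 (σ (i, j, c)) with h | h
      · exact Or.inl (Or.inl ⟨c, hc, h⟩)
      · exact Or.inr (Or.inr ⟨c, hc, h⟩)
    · rcases le_total 0 (σ (j, i, c)) with h | h
      · exact Or.inr (Or.inl ⟨c, hc, h⟩)
      · exact Or.inl (Or.inr ⟨c, hc, h⟩)
  have hdS : Dominant K σ S := by
    rintro i - j hj (⟨c, hk, -⟩ | ⟨c, hk, -⟩)
    · exact hj (hK _ hk).1
    · exact hj (hK _ hk).2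
  obtain ⟨T, hT, hmin⟩ := Finset.exists_min_image
    (S.powerset.filter fun T => T.Nonempty ∧ Dominant K σ T) Finset.card
    ⟨S, by simp [hS, hdS]⟩
  simp only [Finset.mem_filter, Finset.mem_powerset] at hT hmin
  obtain ⟨hTS, hTne, hTd⟩ := hT
  have hnested : ∀ T T', T ⊆ S → T' ⊆ S → Dominant K σ T → Dominant K σ T' →
      T ⊆ T' ∨ T' ⊆ T := by
    intro T T' hT hT' hd hd'
    by_contra! h
    obtain ⟨i, hi, hi'⟩ := Finset.not_subset.1 h.1
    obtain ⟨j, hj, hj'⟩ := Finset.not_subset.1 h.2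
    rcases hbeats i (hT hi) j (hT' hj) (by rintro rfl; exact hi' hj) with hb | hb
    · exact hd' j hj i hi' hb
    · exact hd i hi j hj' hb
  have hrestr : ∀ T T', Dominant K σ T →
      Dominant (within K T') (restrict (within K T') σ) T := fun T T' hd i hi j hj hb =>
    hd i hi j hj (beats_within_iff.1 hb).2.2
  refine ⟨T, ⟨hTS, hTd, hTne, ?_⟩, ?_⟩
  · intro U hUT hUne hUd
    refine Finset.eq_of_subset_of_card_le hUT (hmin U ⟨hUT.trans hTS, hUne, ?_⟩)
    intro i hi j hj hb
    by_cases hjT : j ∈ T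
    · exact hUd i hi j hj (beats_within_iff.2 ⟨hjT, hUT hi, hb⟩)
    · exact hTd i (hUT hi) j hjT hb
  · rintro T' ⟨hT'S, hT'd, hT'i⟩
    have hle : T.card ≤ T'.card := hmin T' ⟨hT'S, hT'i.1, hT'd⟩
    rcases hnested T T' hTS hT'S hTd hT'd with h | h
    · exact (hT'i.2 T h hTne (hrestr T T' hTd)).symm
    · exact Finset.eq_of_subset_of_card_le h hle

/-- Splitting off the least dominant set of coordinates. -/
theorem phi_within_eq_sum {K : Finset (DiffEq n)}
    (htot : ∀ i j, i ≠ j → ∃ c, (i, j, c) ∈ K ∨ (j, i, c) ∈ K) {S : Finset (Fin n)}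
    (hS : S.Nonempty) (z : ℚ) :
    phi (within K S) z =
      ∑ T ∈ S.powerset with T.Nonempty, boundedPhi K T z * phi (within K (S \ T)) z := by
  have hterm : ∀ T ∈ S.powerset, boundedPhi K T z * phi (within K (S \ T)) z =
      ∑ σ ∈ covectors (within K S) with Dominant (within K S) σ T ∧
        Indecomposable (within (within K S) T) (restrict (within (within K S) T) σ) T,
        z ^ rk (zeros (within K S) σ) := by
    intro T hT
    have h1 : within (within K S) T = within K T := by
      rw [within_within, Finset.inter_eq_right.2 (Finset.mem_powerset.1 hT)]
    have h2 : within (within K S) Tᶜ = within K (S \ T) := by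
      rw [within_within, Finset.sdiff_eq_inter_compl]
    rw [sum_dominant (within K S) T
      (fun σ => Indecomposable (within (within K S) T) σ T), h1, h2, boundedPhi]
  rw [Finset.sum_congr rfl fun T hT => hterm T (Finset.mem_filter.1 hT).1]
  simp only [Finset.sum_filter]
  have hne : ∀ T ∈ S.powerset, (if T.Nonempty then
      ∑ σ ∈ covectors (within K S), (if Dominant (within K S) σ T ∧
        Indecomposable (within (within K S) T) (restrict (within (within K S) T) σ) T then
        z ^ rk (zeros (within K S) σ) else 0) else 0) =
      ∑ σ ∈ covectors (within K S), (if Dominant (within K S) σ T ∧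
        Indecomposable (within (within K S) T) (restrict (within (within K S) T) σ) T then
        z ^ rk (zeros (within K S) σ) else 0) := by
    intro T _
    split_ifs with h
    · rfl
    · exact (Finset.sum_eq_zero fun σ _ => if_neg fun h' => h h'.2.1).symm
  rw [Finset.sum_congr rfl hne, Finset.sum_comm, phi]
  refine Finset.sum_congr rfl fun σ _ => ?_
  obtain ⟨T, ⟨hTS, hT⟩, huniq⟩ := existsUnique_dominant (K := within K S) hS
    (fun k hk => (mem_within.1 hk).2) (fun i hi j hj hij => by
      obtain ⟨c, hc⟩ := htot i j hij
      exact ⟨c, by simpa [hi, hj] using hc⟩) σ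
  rw [Finset.sum_eq_single_of_mem T (Finset.mem_powerset.2 hTS), if_pos hT]
  intro T' hT' hne
  exact if_neg fun h => hne (huniq T' ⟨Finset.mem_powerset.1 hT', h⟩)

/-! ### Exponential generating functions -/

/-- The exponential generating function of a sequence of rational numbers. -/
def egf (c : ℕ → ℚ) : PowerSeries ℚ := PowerSeries.mk fun n => (n.factorial : ℚ)⁻¹ * c n

@[simp] theorem coeff_egf (c : ℕ → ℚ) (n : ℕ) :
    PowerSeries.coeff n (egf c) = (n.factorial : ℚ)⁻¹ * c n := by
  simp [egf]

theorem factorial_mul_coeff_egf (c : ℕ → ℚ) (n : ℕ) :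
    (n.factorial : ℚ) * PowerSeries.coeff n (egf c) = c n := by
  rw [coeff_egf, mul_inv_cancel_left₀ (by positivity)]

theorem egf_factorial_mul_coeff (f : PowerSeries ℚ) :
    egf (fun n => (n.factorial : ℚ) * PowerSeries.coeff n f) = f := by
  ext n
  rw [coeff_egf, inv_mul_cancel_left₀ (by positivity)]

/-- The product of exponential generating functions enumerates subsets. -/
theorem sum_powerset_egf {α : Type*} (S : Finset α) (a b : ℕ → ℚ) :
    ∑ T ∈ S.powerset, a T.card * b (S.card - T.card) =
      (S.card.factorial : ℚ) * PowerSeries.coeff S.card (egf a * egf b) := by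
  rw [Finset.sum_powerset_apply_card (fun k => a k * b (S.card - k)), PowerSeries.coeff_mul,
    Finset.Nat.sum_antidiagonal_eq_sum_range_succ
      (fun i j => PowerSeries.coeff i (egf a) * PowerSeries.coeff j (egf b)), Finset.mul_sum]
  refine Finset.sum_congr rfl fun k hk => ?_
  have hk' : k ≤ S.card := by simpa [Nat.lt_succ_iff] using hk
  rw [coeff_egf, coeff_egf, nsmul_eq_mul, Nat.cast_choose ℚ hk']
  have h1 : (k.factorial : ℚ) ≠ 0 := by positivity
  have h2 : ((S.card - k).factorial : ℚ) ≠ 0 := by positivity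
  field_simp

/-- The functions to `Fin (q + 1)` with a given zero set are functions to `Fin q` on the
complement of this set. -/
theorem sum_zeroSet_eq {α : Type} [Fintype α] [DecidableEq α] (q : ℕ) (c : ℕ → ℚ) (T : Finset α) :
    ∑ m : α → Fin (q + 1) with (Finset.univ.filter fun x => m x = 0) = T,
        ∏ i, c (Finset.univ.filter fun x => m x = i).card =
      c T.card * ∑ g : {x // x ∉ T} → Fin q, ∏ i, c (Finset.univ.filter fun x => g x = i).card := by
  rw [Finset.mul_sum]
  symm
  refine Finset.sum_bij (fun g _ => fun x => if h : x ∈ T then 0 else (g ⟨x, h⟩).succ) ?_ ?_ ?_ ?_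
  · intro g _
    rw [Finset.mem_filter]
    refine ⟨Finset.mem_univ _, ?_⟩
    ext x
    by_cases hx : x ∈ T <;> simp [hx]
  · intro g _ g' _ h
    funext x
    have := congrFun h x
    simpa [x.2] using this
  · intro m hm
    have hm' := (Finset.mem_filter.1 hm).2
    have hx : ∀ x : {x // x ∉ T}, m x ≠ 0 := fun x h0 => x.2 (hm'.subset (by simp [h0]))
    refine ⟨fun x => (m x).pred (hx x), Finset.mem_univ _, ?_⟩
    funext x
    by_cases h : x ∈ T
    · have : m x = 0 := by
        rw [← hm'] at h
        simpa using h
      simp [h, this]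
    · simp [h]
  · intro g _
    rw [Fin.prod_univ_succ]
    congr 1
    · congr 2
      ext x
      by_cases hx : x ∈ T <;> simp [hx]
    · refine Finset.prod_congr rfl fun i _ => congrArg c ?_
      refine Finset.card_bij (fun x _ => x.1) ?_ ?_ ?_
      · intro x hx
        simpa [x.2] using hx
      · intro x _ y _ h
        exact Subtype.ext h
      · intro x hx
        by_cases h : x ∈ T
        · simp [h, eq_comm] at hx
        · exact ⟨⟨x, h⟩, by simpa [h] using hx, rfl⟩

/-- Powers of an exponential generating function enumerate functions by the sizes of their
fibres. -/
theorem sum_fibres_egf (q : ℕ) (c : ℕ → ℚ) (α : Type) [Fintype α] [DecidableEq α] :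
    ∑ m : α → Fin q, ∏ i, c (Finset.univ.filter fun x => m x = i).card =
      ((Fintype.card α).factorial : ℚ) * PowerSeries.coeff (Fintype.card α) (egf c ^ q) := by
  induction q generalizing α with
  | zero =>
    rw [pow_zero, PowerSeries.coeff_one]
    rcases isEmpty_or_nonempty α with h | h
    · simp
    · simp [Fintype.card_ne_zero]
  | succ q ih =>
    rw [← Finset.sum_fiberwise_of_maps_to
      (g := fun m : α → Fin (q + 1) => Finset.univ.filter fun x => m x = 0)
      (t := (Finset.univ : Finset α).powerset) (fun _ _ => by simp)]
    simp only [sum_zeroSet_eq, ih]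
    rw [pow_succ', ← egf_factorial_mul_coeff (egf c ^ q), ← Finset.card_univ, ← sum_powerset_egf]
    refine Finset.sum_congr rfl fun T _ => ?_
    have : Fintype.card {x // x ∉ T} = (Finset.univ : Finset α).card - T.card := by
      rw [Fintype.card_subtype_compl, Fintype.card_coe, Finset.card_univ]
    rw [this, egf_factorial_mul_coeff]

/-! ### Exponential sequences of arrangements -/

theorem mem_direction_hyp {k : DiffEq n} (hk : k.1 ≠ k.2.1) (v : E n) :
    v ∈ (hyp k).direction ↔ v k.1 = v k.2.1 := by
  have hp : EuclideanSpace.single k.1 k.2.2 ∈ hyp k := by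
    rw [mem_hyp, defect]
    simp [hk.symm]
  rw [← AffineSubspace.vadd_mem_iff_mem_direction v hp, vadd_eq_add, add_comm, mem_hyp,
    defect_add, mem_hyp.1 hp, zero_add, sub_eq_zero]

theorem hyp_ne_bot {k : DiffEq n} (hk : k.1 ≠ k.2.1) : hyp k ≠ ⊥ := by
  rw [← AffineSubspace.nonempty_iff_ne_bot]
  refine ⟨EuclideanSpace.single k.1 k.2.2, ?_⟩
  rw [SetLike.mem_coe, mem_hyp, defect]
  simp [hk.symm]

theorem subArr_arr {K : Finset (DiffEq n)} (hK : ∀ k ∈ K, k.1 ≠ k.2.1) (S : Finset (Fin n)) :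
    subArr (arr K) S = arr (within K S) := by
  ext H
  simp only [subArr, Finset.mem_filter, mem_arr, mem_within]
  constructor
  · rintro ⟨⟨k, hk, rfl⟩, i, hi, j, hj, hij, hpar⟩
    have hd : ∀ v : E n, v k.1 = v k.2.1 ↔ v i = v j := by
      intro v
      rw [← mem_direction_hyp (hK k hk), hpar.direction_eq]
      exact mem_direction_hyp (k := (i, j, 0)) hij v
    have key : ∀ l, l = i ∨ l = j → l = k.1 ∨ l = k.2.1 := by
      intro l hl
      by_contra! h
      have := (hd (EuclideanSpace.single l 1)).1 (by simp [h.1.symm, h.2.symm])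
      rcases hl with rfl | rfl
      · simp [hij.symm] at this
      · simp [hij] at this
    refine ⟨k, ⟨hk, ?_⟩, rfl⟩
    rcases key i (Or.inl rfl) with h1 | h1 <;> rcases key j (Or.inr rfl) with h2 | h2
    · exact absurd (h1.trans h2.symm) hij
    · exact ⟨h1 ▸ hi, h2 ▸ hj⟩
    · exact ⟨h2 ▸ hj, h1 ▸ hi⟩
    · exact absurd (h1.trans h2.symm) hij
  · rintro ⟨k, ⟨hk, h1, h2⟩, rfl⟩
    refine ⟨⟨k, hk, rfl⟩, k.1, h1, k.2.1, h2, hK k hk, ?_⟩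
    rw [AffineSubspace.parallel_iff_direction_eq_and_eq_bot_iff_eq_bot]
    have hk' := hK k hk
    refine ⟨?_, iff_of_false (hyp_ne_bot hk') (hyp_ne_bot (k := (k.1, k.2.1, 0)) hk')⟩
    ext v
    rw [mem_direction_hyp hk']
    exact (mem_direction_hyp (k := (k.1, k.2.1, 0)) hk' v).symm

theorem IsDeformedBraid.exists_diffEq {A : Arrangement n} (hA : IsDeformedBraid A) :
    ∃ K : Finset (DiffEq n), A = arr K ∧ (∀ k ∈ K, k.1 ≠ k.2.1) ∧
      ∀ i j, i ≠ j → ∃ c, (i, j, c) ∈ K ∨ (j, i, c) ∈ K := by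
  obtain ⟨a, ha, hA⟩ := hA
  let K : Finset (DiffEq n) := Finset.univ.biUnion fun i => Finset.univ.biUnion fun j =>
    if i < j then (a i j).image fun c => (i, j, c) else ∅
  have hK : ∀ i j c, (i, j, c) ∈ K ↔ i < j ∧ c ∈ a i j := by
    intro i j c
    simp only [K, Finset.mem_biUnion, Finset.mem_univ, true_and]
    constructor
    · rintro ⟨i', j', h⟩
      split_ifs at h with hlt
      · obtain ⟨c', hc, h⟩ := Finset.mem_image.1 h
        simp only [Prod.mk.injEq] at h
        obtain ⟨rfl, rfl, rfl⟩ := h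
        exact ⟨hlt, hc⟩
      · simp at h
    · rintro ⟨hlt, hc⟩
      exact ⟨i, j, by rw [if_pos hlt]; exact Finset.mem_image_of_mem _ hc⟩
  refine ⟨K, ?_, ?_, ?_⟩
  · ext H
    rw [hA, mem_arr]
    constructor
    · rintro ⟨i, j, hlt, c, hc, rfl⟩
      exact ⟨(i, j, c), (hK _ _ _).2 ⟨hlt, hc⟩, rfl⟩
    · rintro ⟨⟨i, j, c⟩, hk, rfl⟩
      obtain ⟨hlt, hc⟩ := (hK _ _ _).1 hk
      exact ⟨i, j, hlt, c, hc, rfl⟩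
  · rintro ⟨i, j, c⟩ hk
    exact ((hK _ _ _).1 hk).1.ne
  · intro i j hij
    rcases lt_or_gt_of_ne hij with h | h
    · obtain ⟨c, hc⟩ := ha i j h
      exact ⟨c, Or.inl ((hK _ _ _).2 ⟨h, hc⟩)⟩
    · obtain ⟨c, hc⟩ := ha j i h
      exact ⟨c, Or.inr ((hK _ _ _).2 ⟨h, hc⟩)⟩

/-- An exponential sequence of arrangements, presented by systems of difference equations; the
system `K 0` is empty. -/
structure IsPresentation (A : ∀ n : ℕ, Arrangement n) (K : ∀ n : ℕ, Finset (DiffEq n)) :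
    Prop where
  eq_arr : ∀ n, 1 ≤ n → A n = arr (K n)
  total : ∀ n, ∀ i j : Fin n, i ≠ j → ∃ c, (i, j, c) ∈ K n ∨ (j, i, c) ∈ K n
  phi_within : ∀ n (S : Finset (Fin n)) (z : ℚ), phi (within (K n) S) z = phi (K S.card) z
  phi_zero : ∀ z, phi (K 0) z = 1

theorem IsESA.exists_presentation {A : ∀ n : ℕ, Arrangement n} (hA : IsESA A) :
    ∃ K, IsPresentation A K := by
  have h : ∀ n, ∃ K : Finset (DiffEq n), (1 ≤ n → A n = arr K) ∧ (∀ k ∈ K, k.1 ≠ k.2.1) ∧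
      ∀ i j, i ≠ j → ∃ c, (i, j, c) ∈ K ∨ (j, i, c) ∈ K := by
    intro n
    rcases Nat.eq_zero_or_pos n with rfl | hn
    · exact ⟨∅, fun h => absurd h (by norm_num), by simp, fun i => i.elim0⟩
    · obtain ⟨K, h1, h2⟩ := (hA.deformedBraid n hn).exists_diffEq
      exact ⟨K, fun _ => h1, h2⟩
  choose K hK1 hK2 hK3 using h
  have h0 : ∀ z, phi (K 0) z = 1 := by
    intro z
    rw [show K 0 = ∅ from Finset.eq_empty_of_forall_notMem fun k => k.1.elim0, phi_empty]
  refine ⟨K, hK1, hK3, fun n S z => ?_, h0⟩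
  rcases S.eq_empty_or_nonempty with rfl | hS
  · rw [Finset.card_empty, h0, show within (K n) ∅ = ∅ from
      Finset.eq_empty_of_forall_notMem fun k hk => by simp at hk, phi_empty]
  · have hn : 1 ≤ n := by
      obtain ⟨i, -⟩ := hS
      exact Nat.one_le_iff_ne_zero.2 fun h => (h ▸ i).elim0
    obtain ⟨e⟩ := hA.iso n hn S hS
    rw [hK1 n hn, hK1 _ hS.card_pos, subArr_arr (hK2 n)] at e
    exact phi_eq_of_orderIso e z

/-- The exponential generating function of all cells, by codimension. -/
def cellSeries (K : ∀ n : ℕ, Finset (DiffEq n)) (z : ℚ) : PowerSeries ℚ :=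
  egf fun n => phi (K n) z

variable {A : ∀ n : ℕ, Arrangement n} {K : ∀ n : ℕ, Finset (DiffEq n)}

theorem IsPresentation.constantCoeff_cellSeries (h : IsPresentation A K) (z : ℚ) :
    PowerSeries.constantCoeff (cellSeries K z) = 1 := by
  rw [← PowerSeries.coeff_zero_eq_constantCoeff_apply, cellSeries, coeff_egf, h.phi_zero]
  simp

theorem IsPresentation.cellSeries_mul_inv (h : IsPresentation A K) (z : ℚ) :
    cellSeries K z * (cellSeries K z)⁻¹ = 1 :=
  PowerSeries.mul_inv_cancel _ (by rw [h.constantCoeff_cellSeries]; exact one_ne_zero)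

/-- The numbers of cells with bounded coordinate differences are determined by the numbers of all
cells, through the recursion that splits off the least dominant set. -/
theorem IsPresentation.boundedPhi_eq (h : IsPresentation A K) (z : ℚ) {n : ℕ} (S : Finset (Fin n))
    (hS : S.Nonempty) : boundedPhi (K n) S z =
      (S.card.factorial : ℚ) * PowerSeries.coeff S.card (1 - (cellSeries K z)⁻¹) := by
  induction S using Finset.strongInduction with
  | H S ih =>
    let γ : ℕ → ℚ := fun k =>
      (k.factorial : ℚ) * PowerSeries.coeff k (1 - (cellSeries K z)⁻¹)
    have hγ : egf γ = 1 - (cellSeries K z)⁻¹ := egf_factorial_mul_coeff _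
    have hγ0 : γ 0 = 0 := by
      simp [γ, PowerSeries.coeff_zero_eq_constantCoeff_apply, PowerSeries.constantCoeff_inv,
        h.constantCoeff_cellSeries]
    have hmul : egf γ * cellSeries K z = cellSeries K z - 1 := by
      rw [hγ, sub_mul, one_mul, mul_comm _⁻¹, h.cellSeries_mul_inv]
    have hcard : S.card ≠ 0 := hS.card_pos.ne'
    have h1 := sum_powerset_egf S γ (fun n => phi (K n) z)
    have h2 : (S.card.factorial : ℚ) * PowerSeries.coeff S.card (egf γ * cellSeries K z) =
        phi (K S.card) z := by
      rw [hmul, map_sub, PowerSeries.coeff_one, if_neg hcard, sub_zero, cellSeries,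
        factorial_mul_coeff_egf]
    have h3 := phi_within_eq_sum (h.total n) hS z
    rw [h.phi_within] at h3
    have h4 : ∑ T ∈ S.powerset with T.Nonempty, boundedPhi (K n) T z * phi (within (K n) (S \ T)) z =
        ∑ T ∈ S.powerset with T.Nonempty, γ T.card * phi (K (S.card - T.card)) z := by
      rw [← h3, ← h2, ← cellSeries] at *
      rw [← h1, Finset.sum_filter]
      refine Finset.sum_congr rfl fun T _ => ?_
      split_ifs with hT
      · rfl
      · rw [Finset.not_nonempty_iff_eq_empty.1 hT, Finset.card_empty, hγ0, zero_mul]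
    have hmem : S ∈ S.powerset.filter (·.Nonempty) := by simp [hS]
    rw [← Finset.add_sum_erase _ _ hmem, ← Finset.add_sum_erase _ _ hmem] at h4
    have h5 : ∑ T ∈ (S.powerset.filter (·.Nonempty)).erase S,
          boundedPhi (K n) T z * phi (within (K n) (S \ T)) z =
        ∑ T ∈ (S.powerset.filter (·.Nonempty)).erase S,
          γ T.card * phi (K (S.card - T.card)) z := by
      refine Finset.sum_congr rfl fun T hT => ?_
      obtain ⟨hne, hT⟩ := Finset.mem_erase.1 hT
      obtain ⟨hTS, hTne⟩ := Finset.mem_filter.1 hT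
      rw [Finset.mem_powerset] at hTS
      rw [ih T (Finset.ssubset_iff_subset_ne.2 ⟨hTS, hne⟩) hTne, h.phi_within,
        Finset.card_sdiff_of_subset hTS]
    rw [h5, h.phi_within, sdiff_self, Finset.bot_eq_empty, Finset.card_empty, Nat.sub_self,
      h.phi_zero, mul_one, mul_one] at h4
    exact add_right_cancel h4

/-! ### Evaluation of the generating functions -/

theorem faceCount_arr (K : Finset (DiffEq n)) (d l : ℕ) :
    faceCount (arr K) d l = ((covectors K).filter fun σ =>
      n - rk (zeros K σ) = d ∧ level (cell K σ) = l).card := by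
  have : {F | F ∈ faces (arr K) ∧ faceDim F = d ∧ level F = l} =
      cell K '' ((covectors K).filter fun σ =>
        n - rk (zeros K σ) = d ∧ level (cell K σ) = l : Finset _) := by
    ext F
    simp only [Set.mem_ofPred_eq, faces_arr, Set.mem_image, Finset.coe_filter]
    constructor
    · rintro ⟨⟨σ, hσ, rfl⟩, hd, hl⟩
      exact ⟨σ, ⟨hσ, faceDim_cell hσ ▸ hd, hl⟩, rfl⟩
    · rintro ⟨σ, ⟨hσ, hd, hl⟩, rfl⟩
      exact ⟨⟨σ, hσ, rfl⟩, (faceDim_cell hσ).trans hd, hl⟩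
  rw [faceCount, this, Set.InjOn.ncard_image, Set.ncard_coe_finset]
  exact (injOn_cell K).mono fun σ hσ => (Finset.mem_filter.1 hσ).1

theorem sum_faceCount_arr (K : Finset (DiffEq n)) (l : ℕ) (a : ℚ) :
    ∑ d ∈ Finset.Icc l n, (faceCount (arr K) d l : ℚ) * a ^ (n - d) =
      ∑ σ ∈ covectors K with level (cell K σ) = l, a ^ rk (zeros K σ) := by
  rw [← Finset.sum_fiberwise_of_maps_to (g := fun σ => n - rk (zeros K σ)) (t := Finset.Icc l n)]
  · refine Finset.sum_congr rfl fun d _ => ?_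
    rw [faceCount_arr, ← nsmul_eq_mul, ← Finset.sum_const, Finset.filter_filter]
    refine Finset.sum_congr (Finset.filter_congr fun σ _ => and_comm) fun σ hσ => ?_
    have := rk_le (zeros K σ)
    rw [← (Finset.mem_filter.1 hσ).2.2, Nat.sub_sub_self this]
  · intro σ hσ
    obtain ⟨h1, h2⟩ := Finset.mem_filter.1 hσ
    have := level_le_faceDim h1
    rw [faceDim_cell h1, h2] at this
    exact Finset.mem_Icc.2 ⟨this, Nat.sub_le _ _⟩

/-- Evaluation at `x = a`, `t = b`, coefficientwise on power series in `y`. -/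
def evalSeries (a b : ℚ) : PowerSeries Pol →+* PowerSeries ℚ :=
  PowerSeries.map (MvPolynomial.eval ![a, b])

theorem coeff_evalSeries (a b : ℚ) (f : PowerSeries Pol) (n : ℕ) :
    PowerSeries.coeff n (evalSeries a b f) =
      MvPolynomial.eval ![a, b] (PowerSeries.coeff n f) := by
  simp [evalSeries]

/-- Power series over `ℚ[x, t]` are determined by their values at the non-positive integers
`t`. -/
theorem eq_of_evalSeries {f g : PowerSeries Pol}
    (h : ∀ (a : ℚ) (q : ℕ), evalSeries a (-q) f = evalSeries a (-q) g) : f = g := by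
  ext1 n
  refine MvPolynomial.funext_set ![Set.univ, Set.range fun q : ℕ => -(q : ℚ)] ?_ ?_
  · intro i
    fin_cases i
    · exact Set.infinite_univ
    · exact Set.infinite_range_of_injective fun p q hpq => by simpa using hpq
  · intro x hx
    obtain ⟨q, hq⟩ := hx 1 (Set.mem_univ _)
    have hx : x = ![x 0, -(q : ℚ)] := by
      funext i
      fin_cases i
      · rfl
      · exact hq.symm
    rw [hx, ← coeff_evalSeries, ← coeff_evalSeries, h]

theorem coeff_evalSeries_negArgs (a b : ℚ) (f : PowerSeries Pol) (n : ℕ) :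
    PowerSeries.coeff n (evalSeries a b (negArgs f)) =
      (-1) ^ n * PowerSeries.coeff n (evalSeries (-a) b f) := by
  rw [coeff_evalSeries, coeff_evalSeries, negArgs, PowerSeries.coeff_rescale, map_mul, map_pow,
    map_neg, map_one, PowerSeries.coeff_map]
  congr 1
  generalize PowerSeries.coeff n f = p
  have : ((MvPolynomial.eval ![a, b]).comp
      (MvPolynomial.aeval ![-xVar, tVar] : Pol →ₐ[ℚ] Pol).toRingHom) =
      MvPolynomial.eval ![-a, b] := by
    apply MvPolynomial.ringHom_ext
    · intro r; simp
    · intro i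
      fin_cases i <;> simp [xVar, tVar]
  exact congrArg (fun φ : Pol →+* ℚ => φ p) this

theorem IsPresentation.coeff_evalSeries_levelGF (h : IsPresentation A K) (a b : ℚ) {n : ℕ}
    (hn : 1 ≤ n) (l : ℕ) : PowerSeries.coeff n (evalSeries a b (levelGF A l)) =
      (n.factorial : ℚ)⁻¹ *
        ∑ σ ∈ covectors (K n) with level (cell (K n) σ) = l, a ^ rk (zeros (K n) σ) := by
  rw [coeff_evalSeries, levelGF, PowerSeries.coeff_mk, ← sum_faceCount_arr, h.eq_arr n hn]
  simp [xVar]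

theorem IsPresentation.evalSeries_negArgs_levelGF_one (h : IsPresentation A K) (a b : ℚ) :
    evalSeries a b (1 - negArgs (levelGF A 1)) =
      PowerSeries.rescale (-1) (cellSeries K (-a))⁻¹ := by
  ext n
  rw [map_sub, map_one, map_sub, coeff_evalSeries_negArgs, PowerSeries.coeff_rescale]
  rcases Nat.eq_zero_or_pos n with rfl | hn
  · rw [coeff_evalSeries, coeff_levelGF_of_lt A one_pos]
    simp [PowerSeries.coeff_zero_eq_constantCoeff_apply, PowerSeries.constantCoeff_inv,
      h.constantCoeff_cellSeries]
  · have : NeZero n := ⟨hn.ne'⟩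
    have hg := h.boundedPhi_eq (-a) (Finset.univ : Finset (Fin n)) Finset.univ_nonempty
    have hw : within (K n) Finset.univ = K n := by ext; simp
    rw [Finset.card_univ, Fintype.card_fin, map_sub, PowerSeries.coeff_one, if_neg hn.ne', boundedPhi,
      hw] at hg
    rw [h.coeff_evalSeries_levelGF _ _ hn, PowerSeries.coeff_one, if_neg hn.ne',
      Finset.filter_congr fun σ hσ => level_eq_one_iff hσ, hg,
      inv_mul_cancel_left₀ (by positivity)]
    ring

theorem IsPresentation.evalSeries_negArgs_totalGF (h : IsPresentation A K) (a b : ℚ) :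
    evalSeries a b (1 + negArgs (totalGF A)) = PowerSeries.rescale (-1) (cellSeries K (-a)) := by
  ext n
  rw [map_add, map_one, map_add, coeff_evalSeries_negArgs, PowerSeries.coeff_rescale]
  have ht : PowerSeries.coeff n (evalSeries (-a) b (totalGF A)) =
      ∑ l ∈ Finset.Icc 1 n, PowerSeries.coeff n (evalSeries (-a) b (levelGF A l)) := by
    simp [coeff_evalSeries, totalGF]
  rw [ht]
  rcases Nat.eq_zero_or_pos n with rfl | hn
  · simp [h.constantCoeff_cellSeries]
  · have : NeZero n := ⟨hn.ne'⟩
    rw [Finset.sum_congr rfl fun l _ => h.coeff_evalSeries_levelGF _ _ hn l, ← Finset.mul_sum,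
      Finset.sum_fiberwise_of_maps_to, PowerSeries.coeff_one, if_neg hn.ne', zero_add,
      cellSeries, coeff_egf, phi]
    intro σ hσ
    refine Finset.mem_Icc.2 ⟨one_le_level hσ, (level_le_faceDim hσ).trans ?_⟩
    rw [faceDim_cell hσ]
    exact Nat.sub_le _ _

theorem IsPresentation.evalSeries_whitneyGF (h : IsPresentation A K) (a : ℚ) (q : ℕ) :
    evalSeries a (-q) (whitneyGF A) = PowerSeries.rescale (-1) (cellSeries K (-a)) ^ q := by
  rw [← map_pow]
  ext n
  rw [coeff_evalSeries, whitneyGF, map_add, PowerSeries.coeff_mk, PowerSeries.coeff_rescale]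
  rcases Nat.eq_zero_or_pos n with rfl | hn
  · simp [h.constantCoeff_cellSeries]
  · rw [PowerSeries.coeff_one, if_neg hn.ne', zero_add, if_neg hn.ne', map_mul,
      MvPolynomial.eval_C, h.eq_arr n hn, eval_whitney]
    simp only [phi_monochromatic, h.phi_within]
    have := sum_fibres_egf q (fun n => phi (K n) (-a)) (Fin n)
    rw [Fintype.card_fin] at this
    rw [this, cellSeries]
    field_simp

theorem evalSeries_formalPow (a b : ℚ) {H : PowerSeries Pol}
    (hH : PowerSeries.constantCoeff H = 1) (s : Pol) :
    evalSeries a b (formalPow H s) =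
      (PowerSeries.binomialSeries ℚ (MvPolynomial.eval ![a, b] s)).subst
        (evalSeries a b H - 1) := by
  have hs : PowerSeries.HasSubst (H - 1) :=
    PowerSeries.HasSubst.of_constantCoeff_zero' (by rw [map_sub, hH, map_one, sub_self])
  rw [formalPow]
  refine (PowerSeries.map_subst hs _).trans ?_
  have h1 : (PowerSeries.binomialSeries Pol s).map (MvPolynomial.eval ![a, b]) =
      PowerSeries.binomialSeries ℚ (MvPolynomial.eval ![a, b] s) := by
    ext n
    simp [Ring.map_choose]
  rw [h1]
  congr 1
  exact (map_sub (evalSeries a b) H 1).trans (by rw [map_one])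

theorem subst_binomialSeries_natCast {H : PowerSeries ℚ}
    (hH : PowerSeries.constantCoeff H = 1) (q : ℕ) :
    (PowerSeries.binomialSeries ℚ (q : ℚ)).subst (H - 1) = H ^ q := by
  have hs : PowerSeries.HasSubst (H - 1) :=
    PowerSeries.HasSubst.of_constantCoeff_zero' (by rw [map_sub, hH, map_one, sub_self])
  rw [PowerSeries.binomialSeries_nat, PowerSeries.subst_pow hs]
  congr 1
  rw [PowerSeries.subst_add hs, PowerSeries.subst_X hs, ← PowerSeries.coe_substAlgHom hs, map_one]
  ring

theorem subst_binomialSeries_neg_mul {H : PowerSeries ℚ}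
    (hH : PowerSeries.constantCoeff H = 1) (q : ℕ) :
    (PowerSeries.binomialSeries ℚ (-(q : ℚ))).subst (H - 1) * H ^ q = 1 := by
  have hs : PowerSeries.HasSubst (H - 1) :=
    PowerSeries.HasSubst.of_constantCoeff_zero' (by rw [map_sub, hH, map_one, sub_self])
  rw [← subst_binomialSeries_natCast hH, ← PowerSeries.subst_mul hs,
    ← PowerSeries.binomialSeries_add, neg_add_cancel, PowerSeries.binomialSeries_zero,
    ← PowerSeries.coe_substAlgHom hs, map_one]

theorem constantCoeff_negArgs {f : PowerSeries Pol} (hf : PowerSeries.constantCoeff f = 0) :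
    PowerSeries.constantCoeff (negArgs f) = 0 := by
  rw [← PowerSeries.coeff_zero_eq_constantCoeff_apply, negArgs, PowerSeries.coeff_rescale,
    PowerSeries.coeff_map, PowerSeries.coeff_zero_eq_constantCoeff_apply, hf, map_zero, mul_zero]

theorem IsPresentation.evalSeries_formalPow_levelGF (h : IsPresentation A K) (a : ℚ) (q : ℕ) :
    evalSeries a (-q) (formalPow (1 - negArgs (levelGF A 1)) tVar) =
      PowerSeries.rescale (-1) (cellSeries K (-a)) ^ q := by
  rw [evalSeries_formalPow, h.evalSeries_negArgs_levelGF_one]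
  · have h1 : MvPolynomial.eval ![a, -(q : ℚ)] tVar = -(q : ℚ) := by simp [tVar]
    have h2 : PowerSeries.rescale (-1 : ℚ) (cellSeries K (-a))⁻¹ *
        PowerSeries.rescale (-1) (cellSeries K (-a)) = 1 := by
      rw [← map_mul, mul_comm, h.cellSeries_mul_inv, map_one]
    have h3 := subst_binomialSeries_neg_mul
      (H := PowerSeries.rescale (-1 : ℚ) (cellSeries K (-a))⁻¹) (by
        rw [← PowerSeries.coeff_zero_eq_constantCoeff_apply, PowerSeries.coeff_rescale]
        simp [PowerSeries.constantCoeff_inv, h.constantCoeff_cellSeries]) q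
    rw [h1]
    calc _ = _ * (PowerSeries.rescale (-1 : ℚ) (cellSeries K (-a))⁻¹ *
          PowerSeries.rescale (-1) (cellSeries K (-a))) ^ q := by rw [h2, one_pow, mul_one]
      _ = _ := by rw [mul_pow, ← mul_assoc, h3, one_mul]
  · rw [map_sub, map_one, constantCoeff_negArgs, sub_zero]
    rw [← PowerSeries.coeff_zero_eq_constantCoeff_apply, coeff_levelGF_of_lt A one_pos]

theorem IsPresentation.evalSeries_formalPow_totalGF (h : IsPresentation A K) (a : ℚ) (q : ℕ) :
    evalSeries a (-q) (formalPow (1 + negArgs (totalGF A)) (-tVar)) =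
      PowerSeries.rescale (-1) (cellSeries K (-a)) ^ q := by
  rw [evalSeries_formalPow, h.evalSeries_negArgs_totalGF]
  · have h1 : MvPolynomial.eval ![a, -(q : ℚ)] (-tVar) = (q : ℚ) := by simp [tVar]
    rw [h1, subst_binomialSeries_natCast]
    rw [← PowerSeries.coeff_zero_eq_constantCoeff_apply, PowerSeries.coeff_rescale]
    simp [h.constantCoeff_cellSeries]
  · rw [map_add, map_one, constantCoeff_negArgs, add_zero]
    rw [← PowerSeries.coeff_zero_eq_constantCoeff_apply]
    simp [totalGF]

end LevelFaces

end

theorem theorem4 (A : ∀ n : ℕ, LevelFaces.Arrangement n) (hA : LevelFaces.IsESA A) :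
    LevelFaces.whitneyGF A =
        LevelFaces.formalPow (1 - LevelFaces.negArgs (LevelFaces.levelGF A 1)) LevelFaces.tVar ∧
      LevelFaces.formalPow (1 - LevelFaces.negArgs (LevelFaces.levelGF A 1)) LevelFaces.tVar =
        LevelFaces.formalPow (1 + LevelFaces.negArgs (LevelFaces.totalGF A)) (-LevelFaces.tVar) := by
  obtain ⟨K, hK⟩ := hA.exists_presentation
  constructor
  · refine LevelFaces.eq_of_evalSeries fun a q => ?_
    rw [hK.evalSeries_whitneyGF, hK.evalSeries_formalPow_levelGF]
  · refine LevelFaces.eq_of_evalSeries fun a q => ?_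
    rw [hK.evalSeries_formalPow_levelGF, hK.evalSeries_formalPow_totalGF]
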